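/- Let $T>0$, $\alpha>0$ and $H\in(\frac12,1)$, and let $B=\{B_t\}_{t\in[0,T]}$ be a fractional Brownian motion of Hurst index $H$ on a probability space $(\Omega,\mathcal F,P)$, that is, a centered Gaussian process with $E[B_sB_t]=\frac12\left(t^{2H}+s^{2H}-|t-s|^{2H}\right)$. Let $X=\{X_t\}_{t\in[0,T)}$ be (a version with continuous paths of) the solution of $$X_0=0;\qquad dX_t=-\alpha\,\frac{X_t}{T-t}\,dt+dB_t,\quad 0\le t<T,$$ that is, almost surely $X_t=-\alpha\int_0^t\frac{X_u}{T-u}\,du+B_t$ for all $t\in[0,T)$. For $t\in(0,T)$ consider the least squares estimator $$\widehat\alpha_t=-\left(\int_0^t\frac{X_u}{T-u}\,dX_u\right)\bigg/\left(\int_0^t\frac{X_u^2}{(T-u)^2}\,du\right),$$ where the integral in the numerator is the pathwise Young integral: for $f$ $\gamma$-Hölder and $g$ $\beta$-Hölder on $[0,t]$ with $\gamma,\beta\in(0,1)$, $\gamma+\beta>1$, $\int_0^t f\,dg$ is the limit of the Riemann–Stieltjes sums of $f$ against $g$ as the mesh of the tagged partition tends to $0$. Then: 1. $\widehat\alpha_t\to\alpha\wedge\frac12$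 in probability as $t\to T$, $t<T$. 2. If $\alpha<H$, then $\widehat\alpha_t\to\alpha\wedge\frac12$ almost surely as $t\to T$, $t<T$. 3. $\widehat\alpha_t$ is a strongly consistent estimator of $\alpha$ (that is, $\widehat\alpha_t\to\alpha$ almost surely as $t\to T$, $t<T$) if and only if $\alpha\le\frac12$. -/

import Mathlib

open MeasureTheory ProbabilityTheory Filter Set
open scoped NNReal Topology

noncomputable section

namespace FractionalBridge

/-- `B`, restricted to the time interval `[0, T]`, is a fractional Brownian motion of Hurst index
`H` under `P`: a centered Gaussian process with covariance
`E[B_s B_t] = (t ^ (2H) + s ^ (2H) - |t - s| ^ (2H)) / 2`. -/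
structure IsFBM {Ω : Type*} [MeasurableSpace Ω] (P : Measure Ω) (H T : ℝ)
    (B : ℝ → Ω → ℝ) : Prop where
  isGaussianProcess : IsGaussianProcess (fun t : Icc (0 : ℝ) T => B t) P
  mean_eq_zero : ∀ t ∈ Icc (0 : ℝ) T, ∫ ω, B t ω ∂P = 0
  covariance_eq : ∀ s ∈ Icc (0 : ℝ) T, ∀ t ∈ Icc (0 : ℝ) T,
    ∫ ω, B s ω * B t ω ∂P =
      (t ^ (2 * H) + s ^ (2 * H) - |t - s| ^ (2 * H)) / 2

/-- `X` is a version with continuous paths on `[0, T)` of the solution of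
`X_0 = 0`, `dX_t = -α X_t / (T - t) dt + dB_t`, `0 ≤ t < T`, the equation being understood in its
integrated form, pathwise. -/
def IsBridge {Ω : Type*} [MeasurableSpace Ω] (P : Measure Ω) (α T : ℝ)
    (B X : ℝ → Ω → ℝ) : Prop :=
  ∀ᵐ ω ∂P, ContinuousOn (fun t => X t ω) (Ico 0 T) ∧ X 0 ω = 0 ∧
    ∀ t ∈ Ico (0 : ℝ) T, X t ω = -α * (∫ u in (0 : ℝ)..t, X u ω / (T - u)) + B t ω

/-- `x 0 ≤ x 1 ≤ ... ≤ x n` is a partition of `[a, b]` with tags `τ i ∈ [x i, x (i + 1)]`, all of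
whose intervals are shorter than `δ`. -/
def IsTaggedPartition (a b δ : ℝ) (n : ℕ) (x τ : ℕ → ℝ) : Prop :=
  x 0 = a ∧ x n = b ∧
    ∀ i < n, x i ≤ τ i ∧ τ i ≤ x (i + 1) ∧ x (i + 1) - x i < δ

/-- The Young integral `∫_a^b f dg` exists and equals `I`: for some `γ, β ∈ (0, 1)` with
`γ + β > 1`, `f` is `γ`-Hölder and `g` is `β`-Hölder on `[a, b]`, and the Riemann-Stieltjes sums
of `f` against `g` converge to `I` as the mesh of the tagged partition tends to zero. -/
def HasYoungIntegral (f g : ℝ → ℝ) (a b I : ℝ) : Prop :=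
  a ≤ b ∧
  (∃ γ β C D : ℝ≥0, γ < 1 ∧ β < 1 ∧ 1 < γ + β ∧
    HolderOnWith C γ f (Icc a b) ∧ HolderOnWith D β g (Icc a b)) ∧
  ∀ ε > 0, ∃ δ > 0, ∀ (n : ℕ) (x τ : ℕ → ℝ), IsTaggedPartition a b δ n x τ →
    |(∑ i ∈ Finset.range n, f (τ i) * (g (x (i + 1)) - g (x i))) - I| < ε

/-- The value of a Young integral is unique. -/
theorem HasYoungIntegral.unique {f g : ℝ → ℝ} {a b I J : ℝ}
    (hI : HasYoungIntegral f g a b I) (hJ : HasYoungIntegral f g a b J) : I = J := by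
  obtain ⟨hab, -, hI⟩ := hI
  obtain ⟨-, -, hJ⟩ := hJ
  by_contra hne
  have hpos : 0 < |I - J| / 2 := half_pos (abs_pos.2 (sub_ne_zero.2 hne))
  obtain ⟨δ₁, hδ₁, h₁⟩ := hI _ hpos
  obtain ⟨δ₂, hδ₂, h₂⟩ := hJ _ hpos
  obtain ⟨n, hn⟩ := exists_nat_gt ((b - a) / min δ₁ δ₂)
  have hδ : 0 < min δ₁ δ₂ := lt_min hδ₁ hδ₂
  have hn0 : (0 : ℝ) < n := lt_of_le_of_lt (div_nonneg (sub_nonneg.2 hab) hδ.le) hn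
  have hlt : (b - a) / n < min δ₁ δ₂ := by
    rw [div_lt_iff₀ hδ] at hn
    rw [div_lt_iff₀ hn0]
    linarith
  have hge : 0 ≤ (b - a) / n := div_nonneg (sub_nonneg.2 hab) hn0.le
  let x : ℕ → ℝ := fun i => a + i * ((b - a) / n)
  have hstep : ∀ i, x (i + 1) - x i = (b - a) / n := by
    intro i
    simp only [x]
    push_cast
    ring
  have hx : ∀ δ, (b - a) / n < δ → IsTaggedPartition a b δ n x x := by
    intro δ hδ
    refine ⟨by simp [x], ?_, fun i _ => ⟨le_rfl, ?_, by rw [hstep]; exact hδ⟩⟩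
    · simp only [x]
      field_simp
      ring
    · linarith [hstep i]
  have e₁ := h₁ n x x (hx _ (lt_of_lt_of_le hlt (min_le_left _ _)))
  have e₂ := h₂ n x x (hx _ (lt_of_lt_of_le hlt (min_le_right _ _)))
  rw [abs_lt] at e₁ e₂
  have : |I - J| < |I - J| := by
    nth_rewrite 1 [abs_lt]
    constructor <;> linarith
  exact lt_irrefl _ this

open Classical in
/-- The Young integral `∫_a^b f dg` (and `0` if it does not exist). -/
def youngIntegral (f g : ℝ → ℝ) (a b : ℝ) : ℝ :=
  if h : ∃ I, HasYoungIntegral f g a b I then h.choose else 0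

/-- The least squares estimator
`-(∫_0^t X_u / (T - u) dX_u) / (∫_0^t X_u ^ 2 / (T - u) ^ 2 du)` of `α`, computed from the path
`u ↦ X u ω`, the integral in the numerator being a Young integral. -/
def lse {Ω : Type*} (T : ℝ) (X : ℝ → Ω → ℝ) (t : ℝ) (ω : Ω) : ℝ :=
  -youngIntegral (fun u => X u ω / (T - u)) (fun u => X u ω) 0 t /
    ∫ u in (0 : ℝ)..t, X u ω ^ 2 / (T - u) ^ 2

end FractionalBridge

end

/-! Write `D_t` for the integral of `X_u ^ 2 / (T - u) ^ 2` over `[0, t]`. Integration by parts in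
the Young integral (`hasYoungIntegral_mul_self`) turns the estimator, wherever `D_t ≠ 0`, into `1 /
2 - X_t ^ 2 / (2 (T - t) D_t)`. This needs paths that are Hölder of some order above `1 / 2`, which
Kolmogorov's criterion provides (`IsFBM.ae_holderOn`). Everything then depends on how `X_t ^ 2 / (T
- t)` compares with `D_t` near `T`.

If `α > 1 / 2`, the bridge decays like `(T - t) ^ r` for some `r > 1 / 2` (`abs_bridge_le`), so `X_t
^ 2 / (T - t)` vanishes while `D_t` increases from a positive value: the limit is `1 / 2`.

If `α ≤ 1 / 2`, then `α < H` and `(T - t) ^ (-α) X_t`, the Wiener integral of `(T - u) ^ (-α)`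
against `B`, converges almost surely. Its limit is almost surely nonzero: fractional increments are
positively correlated for `H ≥ 1 / 2`, so the approximating Gaussian variances stay away from zero,
which gives a small ball bound (`IsBridge.ae_tendsto_normalized`). A weighted Cesàro argument shows
that `X_t ^ 2 / ((T - t) D_t)` tends to `1 - 2 α`, and the limit is `α`.

Almost sure convergence to `min α (1 / 2)` thus holds for every `α > 0`. Convergence in probability
follows along sequences, and uniqueness of limits settles when the limit is `α`. -/

namespace FractionalBridge

/-! ### Tagged partitions and Riemann-Stieltjes sums. -/

section Partition

variable {a b δ : ℝ} {n : ℕ} {x τ : ℕ → ℝ}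

theorem IsTaggedPartition.le_of_le (h : IsTaggedPartition a b δ n x τ) {i j : ℕ} (hij : i ≤ j)
    (hj : j ≤ n) : x i ≤ x j := by
  induction j, hij using Nat.le_induction with
  | base => exact le_rfl
  | succ j hij ih =>
    have h2 := h.2.2 j (by omega)
    linarith [ih (by omega)]

theorem IsTaggedPartition.mem_Icc (h : IsTaggedPartition a b δ n x τ) {i : ℕ} (hi : i ≤ n) :
    x i ∈ Icc a b := by
  have h1 := h.le_of_le (Nat.zero_le i) hi
  have h2 := h.le_of_le hi le_rfl
  rw [h.1] at h1
  rw [h.2.1] at h2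
  exact ⟨h1, h2⟩

theorem IsTaggedPartition.sum_sub (h : IsTaggedPartition a b δ n x τ) (F : ℝ → ℝ) :
    ∑ i ∈ Finset.range n, (F (x (i + 1)) - F (x i)) = F b - F a := by
  rw [Finset.sum_range_sub (fun i => F (x i)), h.1, h.2.1]

theorem IsTaggedPartition.le (h : IsTaggedPartition a b δ n x τ) : a ≤ b := by
  have := h.mem_Icc le_rfl
  exact this.1.trans this.2

theorem IsTaggedPartition.tag_mem (h : IsTaggedPartition a b δ n x τ) {i : ℕ} (hi : i < n) :
    τ i ∈ Icc a b :=
  ⟨(h.mem_Icc hi.le).1.trans (h.2.2 i hi).1, (h.2.2 i hi).2.1.trans (h.mem_Icc hi).2⟩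

/-- Summation by parts in the chain rule evaluates one factor at right endpoints, whatever the
original tags are. -/
theorem IsTaggedPartition.right_tags (h : IsTaggedPartition a b δ n x τ) :
    IsTaggedPartition a b δ n x (fun i => x (i + 1)) :=
  ⟨h.1, h.2.1, fun i hi => ⟨(h.2.2 i hi).1.trans (h.2.2 i hi).2.1, le_rfl, (h.2.2 i hi).2.2⟩⟩

theorem IsTaggedPartition.mono (h : IsTaggedPartition a b δ n x τ) {δ' : ℝ} (hδ : δ ≤ δ') :
    IsTaggedPartition a b δ' n x τ :=
  ⟨h.1, h.2.1, fun i hi => ⟨(h.2.2 i hi).1, (h.2.2 i hi).2.1, (h.2.2 i hi).2.2.trans_le hδ⟩⟩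

end Partition

/-- Riemann-Stieltjes sums against a continuously differentiable integrator converge. -/
theorem exists_mesh_abs_sum_sub_integral_lt {a b : ℝ} {g F f : ℝ → ℝ}
    (hg : ContinuousOn g (Icc a b)) (hf : ContinuousOn f (Icc a b))
    (hF : ∀ u ∈ Icc a b, HasDerivAt F (f u) u) {ε : ℝ} (hε : 0 < ε) :
    ∃ δ > 0, ∀ (n : ℕ) (x τ : ℕ → ℝ), IsTaggedPartition a b δ n x τ →
      |(∑ i ∈ Finset.range n, g (τ i) * (F (x (i + 1)) - F (x i))) - ∫ u in a..b, g u * f u|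
        < ε := by
  obtain ⟨M, hM⟩ := isCompact_Icc.exists_bound_of_continuousOn hf
  have huc := isCompact_Icc.uniformContinuousOn_of_continuous hg
  rw [Metric.uniformContinuousOn_iff] at huc
  by_cases hab : a ≤ b
  swap
  · exact ⟨1, one_pos, fun n x τ h => absurd h.le hab⟩
  have hM0 : 0 ≤ M := (norm_nonneg _).trans (hM a ⟨le_rfl, hab⟩)
  -- The total error is at most `η * M * (b - a)`; the added ones keep `η` well defined and the
  -- inequality strict when `M = 0` or `a = b`.
  set η := ε / (2 * (M + 1) * (b - a + 1)) with hη
  have hba : 0 ≤ b - a := sub_nonneg.2 hab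
  have hη0 : 0 < η := by positivity
  obtain ⟨δ, hδ, H⟩ := huc η hη0
  refine ⟨δ, hδ, fun n x τ h => ?_⟩
  have hsub : ∀ i < n, Icc (x i) (x (i + 1)) ⊆ Icc a b := fun i hi =>
    Icc_subset_Icc (h.mem_Icc hi.le).1 (h.mem_Icc hi).2
  have hle : ∀ i < n, x i ≤ x (i + 1) := fun i hi => h.le_of_le (Nat.le_succ i) hi
  have hgf : ∀ i < n, IntervalIntegrable (fun u => g u * f u) volume (x i) (x (i + 1)) :=
    fun i hi => ((hg.mul hf).mono (hsub i hi)).intervalIntegrable_of_Icc (hle i hi)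
  have hff : ∀ i < n, IntervalIntegrable f volume (x i) (x (i + 1)) :=
    fun i hi => (hf.mono (hsub i hi)).intervalIntegrable_of_Icc (hle i hi)
  have hint : ∫ u in a..b, g u * f u =
      ∑ i ∈ Finset.range n, ∫ u in x i..x (i + 1), g u * f u := by
    rw [intervalIntegral.sum_integral_adjacent_intervals hgf, h.1, h.2.1]
  have hterm : ∀ i ∈ Finset.range n,
      |g (τ i) * (F (x (i + 1)) - F (x i)) - ∫ u in x i..x (i + 1), g u * f u|
        ≤ η * M * (x (i + 1) - x i) := by
    intro i hi
    rw [Finset.mem_range] at hi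
    have e : F (x (i + 1)) - F (x i) = ∫ u in x i..x (i + 1), f u := by
      rw [intervalIntegral.integral_eq_sub_of_hasDerivAt _ (hff i hi)]
      intro u hu
      rw [uIcc_of_le (hle i hi)] at hu
      exact hF u (hsub i hi hu)
    rw [e, ← intervalIntegral.integral_const_mul, ← intervalIntegral.integral_sub
      ((hff i hi).const_mul _) (hgf i hi)]
    have := intervalIntegral.norm_integral_le_of_norm_le_const (a := x i) (b := x (i + 1))
      (f := fun u => g (τ i) * f u - g u * f u) (C := η * M) (fun u hu => by
        rw [uIoc_of_le (hle i hi)] at hu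
        have hu' : u ∈ Icc a b := hsub i hi ⟨hu.1.le, hu.2⟩
        rw [← sub_mul, norm_mul]
        have h2 := h.2.2 i hi
        have h1 := (H (τ i) (h.tag_mem hi) u hu' (by
          rw [Real.dist_eq, abs_lt]; constructor <;> linarith [hu.1, hu.2])).le
        rw [Real.dist_eq] at h1
        exact mul_le_mul h1 (hM u hu') (norm_nonneg _) hη0.le)
    rwa [Real.norm_eq_abs, abs_of_nonneg (sub_nonneg.2 (hle i hi))] at this
  rw [hint, ← Finset.sum_sub_distrib]
  refine (Finset.abs_sum_le_sum_abs _ _).trans_lt ((Finset.sum_le_sum hterm).trans_lt ?_)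
  rw [← Finset.mul_sum, h.sum_sub fun u => u]
  have : η * (2 * (M + 1) * (b - a + 1)) = ε := by rw [hη]; field_simp
  nlinarith [mul_nonneg hη0.le hM0, mul_nonneg hη0.le hba, mul_nonneg (mul_nonneg hη0.le hM0) hba]

/-! ### Hölder functions on intervals. -/

theorem holderOnWith_of_abs_sub_le {f : ℝ → ℝ} {s : Set ℝ} {C h : ℝ≥0}
    (H : ∀ u ∈ s, ∀ v ∈ s, |f u - f v| ≤ C * |u - v| ^ (h : ℝ)) : HolderOnWith C h f s := by
  intro u hu v hv
  rw [edist_dist, edist_dist, Real.dist_eq, Real.dist_eq,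
    ENNReal.ofReal_rpow_of_nonneg (abs_nonneg (u - v)) h.coe_nonneg, ← ENNReal.ofReal_coe_nnreal,
    ← ENNReal.ofReal_mul C.coe_nonneg]
  exact ENNReal.ofReal_le_ofReal (H u hu v hv)

/-- `f` is `h`-Hölder continuous on `s` for some constant. -/
def HolderOn (f : ℝ → ℝ) (h : ℝ) (s : Set ℝ) : Prop :=
  ∃ C, 0 ≤ C ∧ ∀ u ∈ s, ∀ v ∈ s, |f u - f v| ≤ C * |u - v| ^ h

theorem HolderOn.mono {f : ℝ → ℝ} {h : ℝ} {s t : Set ℝ} (H : HolderOn f h s) (hts : t ⊆ s) :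
    HolderOn f h t :=
  let ⟨C, hC, H⟩ := H
  ⟨C, hC, fun u hu v hv => H u (hts hu) v (hts hv)⟩

theorem HolderOn.continuousOn {f : ℝ → ℝ} {h : ℝ} {s : Set ℝ} (H : HolderOn f h s) (hh : 0 < h) :
    ContinuousOn f s := by
  obtain ⟨C, hC, H⟩ := H
  exact (holderOnWith_of_abs_sub_le (C := ⟨C, hC⟩) (h := ⟨h, hh.le⟩) H).continuousOn hh

theorem HolderOn.add {f g : ℝ → ℝ} {h : ℝ} {s : Set ℝ} (hf : HolderOn f h s)
    (hg : HolderOn g h s) : HolderOn (fun u => f u + g u) h s := by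
  obtain ⟨C, hC, hf⟩ := hf
  obtain ⟨D, hD, hg⟩ := hg
  refine ⟨C + D, by positivity, fun u hu v hv => ?_⟩
  calc |f u + g u - (f v + g v)| = |(f u - f v) + (g u - g v)| := by ring_nf
    _ ≤ |f u - f v| + |g u - g v| := abs_add_le _ _
    _ ≤ _ := by linarith [hf u hu v hv, hg u hu v hv]

theorem HolderOn.mul {f g : ℝ → ℝ} {h a b : ℝ} (hh : 0 < h) (hf : HolderOn f h (Icc a b))
    (hg : HolderOn g h (Icc a b)) : HolderOn (fun u => f u * g u) h (Icc a b) := by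
  obtain ⟨M, hM⟩ := isCompact_Icc.exists_bound_of_continuousOn (hf.continuousOn hh)
  obtain ⟨N, hN⟩ := isCompact_Icc.exists_bound_of_continuousOn (hg.continuousOn hh)
  obtain ⟨C, hC, hf⟩ := hf
  obtain ⟨D, hD, hg⟩ := hg
  refine ⟨|M| * D + |N| * C, by positivity, fun u hu v hv => ?_⟩
  have e : f u * g u - f v * g v = f u * (g u - g v) + g v * (f u - f v) := by ring
  rw [e]
  refine (abs_add_le _ _).trans ?_
  rw [abs_mul, abs_mul, add_mul, mul_assoc, mul_assoc]
  exact add_le_add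
    (mul_le_mul ((hM u hu).trans (le_abs_self _)) (hg u hu v hv) (abs_nonneg _) (abs_nonneg _))
    (mul_le_mul ((hN v hv).trans (le_abs_self _)) (hf u hu v hv) (abs_nonneg _) (abs_nonneg _))

/-- A Lipschitz function is Hölder continuous on bounded intervals. -/
theorem HolderOn.of_lipschitz {f : ℝ → ℝ} {h a b M : ℝ} (hh : h ≤ 1)
    (hf : ∀ u ∈ Icc a b, ∀ v ∈ Icc a b, |f u - f v| ≤ M * |u - v|) : HolderOn f h (Icc a b) := by
  refine ⟨|M| * |b - a| ^ (1 - h), by positivity, fun u hu v hv => ?_⟩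
  rcases eq_or_ne u v with rfl | huv
  · simp only [sub_self, abs_zero]; positivity
  have h0 : 0 < |u - v| := abs_pos.2 (sub_ne_zero.2 huv)
  have h2 : |u - v| = |u - v| ^ (1 - h) * |u - v| ^ h := by
    rw [← Real.rpow_add h0]; simp
  have h3 : |u - v| ≤ |b - a| := by
    rw [abs_of_nonneg (show 0 ≤ b - a by linarith [hu.1, hu.2]), abs_le]
    constructor <;> linarith [hu.1, hu.2, hv.1, hv.2]
  have h4 : |u - v| ^ (1 - h) ≤ |b - a| ^ (1 - h) :=
    Real.rpow_le_rpow h0.le h3 (by linarith)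
  calc |f u - f v| ≤ M * |u - v| := hf u hu v hv
    _ ≤ |M| * |u - v| := by gcongr; exact le_abs_self _
    _ = |M| * |u - v| ^ (1 - h) * |u - v| ^ h := by rw [mul_assoc, ← h2]
    _ ≤ _ := by gcongr

/-- A continuously differentiable function is Hölder continuous on bounded intervals. -/
theorem HolderOn.of_hasDerivAt {f f' : ℝ → ℝ} {h a b : ℝ} (hh : h ≤ 1)
    (hf' : ContinuousOn f' (Icc a b)) (hf : ∀ u ∈ Icc a b, HasDerivAt f (f' u) u) :
    HolderOn f h (Icc a b) := by
  obtain ⟨M, hM⟩ := isCompact_Icc.exists_bound_of_continuousOn hf'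
  exact .of_lipschitz hh fun u hu v hv =>
    (convex_Icc a b).norm_image_sub_le_of_norm_hasDerivWithin_le
      (fun u hu => (hf u hu).hasDerivWithinAt) hM hv hu

/-! ### Chain rule for the Young integral. -/

/-- The chain rule for the Young integral of `w X` against `X`. -/
theorem hasYoungIntegral_mul_self {a b h : ℝ} (hab : a ≤ b) (hh : 1 / 2 < h) (hh1 : h < 1)
    {w w' X : ℝ → ℝ} (hX : HolderOn X h (Icc a b)) (hw' : ContinuousOn w' (Icc a b))
    (hw : ∀ u ∈ Icc a b, HasDerivAt w (w' u) u) :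
    HasYoungIntegral (fun u => w u * X u) X a b
      ((w b * X b ^ 2 - w a * X a ^ 2 - ∫ u in a..b, X u ^ 2 * w' u) / 2) := by
  have hwH : HolderOn w h (Icc a b) :=
    .of_hasDerivAt hh1.le hw' hw
  have hXc := hX.continuousOn (by linarith)
  obtain ⟨M, hM⟩ := isCompact_Icc.exists_bound_of_continuousOn (hwH.continuousOn (by linarith))
  have hM0 : 0 ≤ M := (norm_nonneg _).trans (hM a ⟨le_rfl, hab⟩)
  obtain ⟨C, hC, hf⟩ := hwH.mul (by linarith) hX
  obtain ⟨D, hD, hX'⟩ := hX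
  refine ⟨hab, ⟨⟨h, by linarith⟩, ⟨h, by linarith⟩, ⟨C, hC⟩, ⟨D, hD⟩, hh1, hh1, ?_, ?_, ?_⟩, ?_⟩
  · rw [← NNReal.coe_lt_coe]
    change 1 < h + h
    linarith
  · exact holderOnWith_of_abs_sub_le hf
  · exact holderOnWith_of_abs_sub_le hX'
  intro ε hε
  obtain ⟨δ₁, hδ₁, H₁⟩ := exists_mesh_abs_sum_sub_integral_lt (g := fun u => X u ^ 2) (hXc.pow 2) hw' hw hε
  set K := C * D + M * D ^ 2 with hK
  have hK0 : 0 ≤ K := by positivity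
  have hba : 0 ≤ b - a := sub_nonneg.2 hab
  -- Each interval of length `d` costs `K * d ^ (2 * h)`. Splitting off one factor `d` to be summed
  -- leaves a power `2 * h - 1 > 0` of the mesh.
  have hlim : Tendsto (fun d : ℝ => K * d ^ (2 * h - 1) * (b - a)) (𝓝[>] 0) (𝓝 0) := by
    have : Tendsto (fun d : ℝ => d ^ (2 * h - 1)) (𝓝[>] 0) (𝓝 (0 ^ (2 * h - 1))) :=
      ((Real.continuousAt_rpow_const 0 _ (Or.inr (by linarith))).tendsto).mono_left
        nhdsWithin_le_nhds
    rw [Real.zero_rpow (by linarith)] at this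
    simpa using (this.const_mul K).mul_const (b - a)
  obtain ⟨δ₂, hδ₂, hδ₂0⟩ :=
    ((hlim.eventually (gt_mem_nhds (half_pos hε))).and self_mem_nhdsWithin).exists
  refine ⟨min δ₁ δ₂, lt_min hδ₁ hδ₂0, fun n x τ hp => ?_⟩
  have h₁ := H₁ n x _ (hp.mono (min_le_left _ _)).right_tags
  have hterm : ∀ i ∈ Finset.range n, |w (τ i) * X (τ i) * (X (x (i + 1)) - X (x i)) -
      ((w (x (i + 1)) * X (x (i + 1)) ^ 2 - w (x i) * X (x i) ^ 2) -
        X (x (i + 1)) ^ 2 * (w (x (i + 1)) - w (x i))) / 2| ≤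
      K * δ₂ ^ (2 * h - 1) * (x (i + 1) - x i) := by
    intro i hi
    rw [Finset.mem_range] at hi
    have hxi := hp.mem_Icc hi.le
    have hxi' := hp.mem_Icc (i := i + 1) hi
    have hti := hp.2.2 i hi
    have htm := hp.tag_mem hi
    -- After subtraction of half the telescoping increment of `w X ^ 2`, corrected by the Stieltjes
    -- term in `w`, only products of two Hölder increments remain.
    have e : w (τ i) * X (τ i) * (X (x (i + 1)) - X (x i)) -
      ((w (x (i + 1)) * X (x (i + 1)) ^ 2 - w (x i) * X (x i) ^ 2) -
        X (x (i + 1)) ^ 2 * (w (x (i + 1)) - w (x i))) / 2 =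
      (w (τ i) * X (τ i) - w (x i) * X (x i)) * (X (x (i + 1)) - X (x i)) -
        w (x i) * (X (x (i + 1)) - X (x i)) ^ 2 / 2 := by ring
    rw [e]
    set d := x (i + 1) - x i with hd
    have hd0 : 0 ≤ d := by linarith
    have h1 : |X (x (i + 1)) - X (x i)| ≤ D * d ^ h := by
      have := hX' _ hxi' _ hxi
      rwa [abs_of_nonneg (show 0 ≤ x (i + 1) - x i from hd0)] at this
    have h2 : |w (τ i) * X (τ i) - w (x i) * X (x i)| ≤ C * d ^ h := by
      refine (hf _ htm _ hxi).trans ?_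
      gcongr
      rw [abs_of_nonneg (by linarith)]
      linarith
    have h3 : |w (x i)| ≤ M := hM _ hxi
    have hdh : 0 ≤ d ^ h := by positivity
    have h4 : d ^ h * d ^ h ≤ δ₂ ^ (2 * h - 1) * d := by
      rcases hd0.eq_or_lt with h0 | h0
      · rw [← h0, Real.zero_rpow (by linarith)]; simp
      rw [← Real.rpow_add h0]
      have : h + h = (2 * h - 1) + 1 := by ring
      rw [this, Real.rpow_add h0, Real.rpow_one]
      gcongr
      · linarith
      · exact hti.2.2.le.trans (min_le_right _ _)
    have h5 : |(w (τ i) * X (τ i) - w (x i) * X (x i)) * (X (x (i + 1)) - X (x i))| ≤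
        C * D * (d ^ h * d ^ h) := by
      rw [abs_mul]
      calc _ ≤ (C * d ^ h) * (D * d ^ h) := mul_le_mul h2 h1 (abs_nonneg _) (by positivity)
        _ = _ := by ring
    have h6 : |w (x i) * (X (x (i + 1)) - X (x i)) ^ 2 / 2| ≤ M * D ^ 2 * (d ^ h * d ^ h) := by
      rw [abs_div, abs_mul, abs_pow]
      have : |w (x i)| * |X (x (i + 1)) - X (x i)| ^ 2 ≤ M * (D * d ^ h) ^ 2 := by gcongr
      rw [abs_two]
      have h0 : 0 ≤ |w (x i)| * |X (x (i + 1)) - X (x i)| ^ 2 := by positivity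
      nlinarith
    calc _ ≤ _ := abs_sub _ _
      _ ≤ C * D * (d ^ h * d ^ h) + M * D ^ 2 * (d ^ h * d ^ h) := add_le_add h5 h6
      _ = K * (d ^ h * d ^ h) := by rw [hK]; ring
      _ ≤ K * (δ₂ ^ (2 * h - 1) * d) := by gcongr
      _ = _ := by ring
  have hsum := (Finset.abs_sum_le_sum_abs _ _).trans (Finset.sum_le_sum hterm)
  rw [Finset.sum_sub_distrib, ← Finset.sum_div, Finset.sum_sub_distrib,
    hp.sum_sub (fun u => w u * X u ^ 2), ← Finset.mul_sum, hp.sum_sub fun u => u] at hsum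
  have h7 := hsum.trans_lt hδ₂
  rw [abs_lt] at h7 h₁ ⊢
  constructor <;> linarith

theorem HasYoungIntegral.youngIntegral_eq {f g : ℝ → ℝ} {a b I : ℝ}
    (h : HasYoungIntegral f g a b I) : youngIntegral f g a b = I := by
  have hex : ∃ I, HasYoungIntegral f g a b I := ⟨I, h⟩
  rw [youngIntegral, dif_pos hex]
  exact hex.choose_spec.unique h

/-! ### Powers of the remaining time, and the bridge equation path by path. -/

theorem hasDerivAt_sub_rpow {T u : ℝ} (hu : u < T) (p : ℝ) :
    HasDerivAt (fun u => (T - u) ^ p) (-(p * (T - u) ^ (p - 1))) u := by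
  have := ((hasDerivAt_id u).const_sub T).rpow_const (p := p) (Or.inl (sub_pos.2 hu).ne')
  exact this.congr_deriv (by simp)

theorem continuousOn_sub_rpow (T p : ℝ) : ContinuousOn (fun u : ℝ => (T - u) ^ p) (Iio T) :=
  fun _ hu => (hasDerivAt_sub_rpow hu p).continuousAt.continuousWithinAt

/-- Keeping the factor `p` on the left covers `p = 0`, which occurs at the critical value `α = 1 /
2`. -/
theorem mul_integral_sub_rpow {T t : ℝ} (ht : t ∈ Ico 0 T) (p : ℝ) :
    p * ∫ u in (0 : ℝ)..t, (T - u) ^ (p - 1) = T ^ p - (T - t) ^ p := by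
  have hs : uIcc 0 t ⊆ Iio T := by
    rw [uIcc_of_le ht.1]; exact fun u hu => hu.2.trans_lt ht.2
  have := intervalIntegral.integral_eq_sub_of_hasDerivAt
    (fun u hu => hasDerivAt_sub_rpow (hs hu) p)
    ((continuousOn_const.mul ((continuousOn_sub_rpow T (p - 1)).mono hs)).neg.intervalIntegrable)
  rw [intervalIntegral.integral_neg, intervalIntegral.integral_const_mul, sub_zero] at this
  linarith

section Bridge

variable {T α h : ℝ} {b x : ℝ → ℝ}

theorem integrand_continuousOn (hx : ContinuousOn x (Ico 0 T)) :
    ContinuousOn (fun u => x u / (T - u)) (Ico 0 T) :=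
  hx.div (by fun_prop) fun _ hu => (sub_pos.2 hu.2).ne'

theorem Icc_subset_Ico_of_lt {t : ℝ} (ht : t < T) : Icc 0 t ⊆ Ico 0 T :=
  fun _ hu => ⟨hu.1, hu.2.trans_lt ht⟩

theorem continuousOn_primitive {f : ℝ → ℝ} (hf : ContinuousOn f (Ico 0 T)) :
    ContinuousOn (fun t => ∫ u in (0 : ℝ)..t, f u) (Ico 0 T) := by
  intro t ht
  obtain ⟨s, hts, hsT⟩ := exists_between ht.2
  have h1 : ContinuousOn (fun t => ∫ u in (0 : ℝ)..t, f u) (uIcc 0 s) := by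
    apply intervalIntegral.continuousOn_primitive_interval
    rw [uIcc_of_le (ht.1.trans hts.le)]
    exact (hf.mono (Icc_subset_Ico_of_lt hsT)).integrableOn_Icc
  rw [uIcc_of_le (ht.1.trans hts.le)] at h1
  refine (h1 t ⟨ht.1, hts.le⟩).mono_of_mem_nhdsWithin ?_
  filter_upwards [self_mem_nhdsWithin, mem_nhdsWithin_of_mem_nhds (Iio_mem_nhds hts)] with u hu hu'
  exact ⟨hu.1, hu'.le⟩

theorem hasDerivAt_primitive {f : ℝ → ℝ} (hf : ContinuousOn f (Ico 0 T)) {t : ℝ}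
    (ht : t ∈ Ioo 0 T) : HasDerivAt (fun t => ∫ u in (0 : ℝ)..t, f u) (f t) t := by
  have hc := (hf.mono Ioo_subset_Ico_self).continuousAt (isOpen_Ioo.mem_nhds ht)
  refine intervalIntegral.integral_hasDerivAt_right ?_ ?_ hc
  · refine ContinuousOn.intervalIntegrable ?_
    rw [uIcc_of_le ht.1.le]
    exact hf.mono (Icc_subset_Ico_of_lt ht.2)
  · exact (hf.mono Ioo_subset_Ico_self).stronglyMeasurableAtFilter isOpen_Ioo t ht

theorem continuousOn_driver (hx : ContinuousOn x (Ico 0 T))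
    (heq : ∀ t ∈ Ico (0 : ℝ) T, x t = -α * (∫ u in (0 : ℝ)..t, x u / (T - u)) + b t) :
    ContinuousOn b (Ico 0 T) :=
  (hx.add (continuousOn_const.mul (continuousOn_primitive (integrand_continuousOn hx)))).congr
    fun t ht => show b t = x t + α * _ by linarith [heq t ht]

/-- The solution of the linear equation in terms of the driving path. -/
theorem bridge_eq (hx : ContinuousOn x (Ico 0 T))
    (heq : ∀ t ∈ Ico (0 : ℝ) T, x t = -α * (∫ u in (0 : ℝ)..t, x u / (T - u)) + b t)
    {t : ℝ} (ht : t ∈ Ico 0 T) :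
    x t = b t - α * (T - t) ^ α * ∫ u in (0 : ℝ)..t, (T - u) ^ (-α - 1) * b u := by
  have hb := continuousOn_driver hx heq
  have hsub := Icc_subset_Ico_of_lt ht.2
  have hlt : Icc 0 t ⊆ Iio T := fun u hu => hu.2.trans_lt ht.2
  have hI := (continuousOn_primitive (integrand_continuousOn hx)).mono hsub
  -- Variation of constants is applied to the drift integral, which is differentiable although `x`
  -- need not be. With the integrating factor `(T - s) ^ (-α)` its derivative involves `b` only.
  have key := intervalIntegral.integral_eq_sub_of_hasDerivAt_of_le ht.1
    (f := fun s => (T - s) ^ (-α) * ∫ u in (0 : ℝ)..s, x u / (T - u))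
    (f' := fun s => (T - s) ^ (-α - 1) * b s)
    (((continuousOn_sub_rpow T _).mono hlt).mul hI) (fun s hs => by
      have hsT : s < T := hs.2.trans ht.2
      have h0 : 0 < T - s := sub_pos.2 hsT
      have hd := (hasDerivAt_sub_rpow hsT (-α)).mul
        (hasDerivAt_primitive (integrand_continuousOn hx) ⟨hs.1, hsT⟩)
      refine hd.congr_deriv ?_
      rw [heq s ⟨hs.1.le, hsT⟩, show (T - s) ^ (-α) = (T - s) ^ (-α - 1) * (T - s) by
        rw [← Real.rpow_add_one h0.ne']; ring_nf]
      field_simp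
      ring)
    ((((continuousOn_sub_rpow T _).mono hlt).mul (hb.mono hsub)).intervalIntegrable_of_Icc ht.1)
  simp only [intervalIntegral.integral_same, mul_zero, sub_zero] at key
  have h0 : 0 < T - t := sub_pos.2 ht.2
  have h1 : (T - t) ^ α * (T - t) ^ (-α) = 1 := by rw [← Real.rpow_add h0]; simp
  rw [key, heq t ht, mul_assoc, ← mul_assoc ((T - t) ^ α), h1]
  ring

/-- Recentring the driver makes its Hölder bound usable against the singular kernel: `c = b t`
serves for strong drift, and `c` the limit of `b` at `T` for weak drift. -/
theorem bridge_eq_sub_const (hx : ContinuousOn x (Ico 0 T))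
    (heq : ∀ t ∈ Ico (0 : ℝ) T, x t = -α * (∫ u in (0 : ℝ)..t, x u / (T - u)) + b t)
    {t : ℝ} (ht : t ∈ Ico 0 T) (c : ℝ) :
    x t = b t - c + c * T ^ (-α) * (T - t) ^ α
      - α * (T - t) ^ α * ∫ u in (0 : ℝ)..t, (T - u) ^ (-α - 1) * (b u - c) := by
  have hb := continuousOn_driver hx heq
  have hsub := Icc_subset_Ico_of_lt ht.2
  have hlt : Icc 0 t ⊆ Iio T := fun u hu => hu.2.trans_lt ht.2
  have hr := (continuousOn_sub_rpow T (-α - 1)).mono hlt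
  simp only [mul_sub]
  have h4 : IntervalIntegrable (fun u => (T - u) ^ (-α - 1) * b u) volume 0 t :=
    (hr.mul (hb.mono hsub)).intervalIntegrable_of_Icc ht.1
  have h5 : IntervalIntegrable (fun u => (T - u) ^ (-α - 1) * c) volume 0 t :=
    (hr.mul continuousOn_const).intervalIntegrable_of_Icc ht.1
  rw [intervalIntegral.integral_sub h4 h5,
    intervalIntegral.integral_mul_const, bridge_eq hx heq ht]
  have h2 := mul_integral_sub_rpow ht (-α)
  have h0 : 0 < T - t := sub_pos.2 ht.2
  have h1 : (T - t) ^ α * (T - t) ^ (-α) = 1 := by rw [← Real.rpow_add h0]; simp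
  have h3 : α * ∫ u in (0 : ℝ)..t, (T - u) ^ (-α - 1) = (T - t) ^ (-α) - T ^ (-α) := by linarith
  linear_combination (-(T - t) ^ α * c) * h3 - c * h1

/-- Away from `T` the drift integral is Lipschitz, so the regularity of the path is that of the
driver. -/
theorem bridge_holder (hh1 : h ≤ 1) (hx : ContinuousOn x (Ico 0 T))
    (heq : ∀ t ∈ Ico (0 : ℝ) T, x t = -α * (∫ u in (0 : ℝ)..t, x u / (T - u)) + b t)
    (hb : HolderOn b h (Ico 0 T)) {t : ℝ} (ht : t < T) : HolderOn x h (Icc 0 t) := by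
  have hsub := Icc_subset_Ico_of_lt ht
  have hc := (integrand_continuousOn hx).mono hsub
  obtain ⟨M, hM⟩ := isCompact_Icc.exists_bound_of_continuousOn hc
  have hI : HolderOn (fun s => -α * ∫ u in (0 : ℝ)..s, x u / (T - u)) h (Icc 0 t) := by
    refine .of_lipschitz (M := |α| * M) hh1 fun u hu v hv => ?_
    have hint : ∀ u ∈ Icc 0 t, IntervalIntegrable (fun u => x u / (T - u)) volume 0 u :=
      fun u hu => (hc.mono (Icc_subset_Icc_right hu.2)).intervalIntegrable_of_Icc hu.1
    rw [← mul_sub, intervalIntegral.integral_interval_sub_left (hint u hu) (hint v hv), abs_mul,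
      abs_neg, mul_assoc]
    gcongr
    refine intervalIntegral.norm_integral_le_of_norm_le_const fun s hs => hM s ?_
    have := uIoc_subset_uIcc hs
    rw [uIcc, mem_Icc] at this
    exact ⟨(le_min hv.1 hu.1).trans this.1, this.2.trans (max_le hv.2 hu.2)⟩
  obtain ⟨C, hC, H⟩ := hI.add (hb.mono hsub)
  exact ⟨C, hC, fun u hu v hv => by rw [heq u (hsub hu), heq v (hsub hv)]; exact H u hu v hv⟩

/-- The least squares estimator is an explicit function of the path. -/
theorem neg_youngIntegral_bridge_div (hh : 1 / 2 < h) (hh1 : h < 1) {t : ℝ} (ht : t ∈ Ico 0 T)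
    (hx : HolderOn x h (Icc 0 t)) (hx0 : x 0 = 0) :
    -youngIntegral (fun u => x u / (T - u)) x 0 t / ∫ u in (0 : ℝ)..t, x u ^ 2 / (T - u) ^ 2 =
      -((x t ^ 2 / (T - t) - ∫ u in (0 : ℝ)..t, x u ^ 2 / (T - u) ^ 2) / 2) /
        ∫ u in (0 : ℝ)..t, x u ^ 2 / (T - u) ^ 2 := by
  have hne : ∀ u ∈ Icc 0 t, T - u ≠ 0 := fun u hu => (sub_pos.2 (hu.2.trans_lt ht.2)).ne'
  have := hasYoungIntegral_mul_self ht.1 hh hh1 (w := fun u => (T - u)⁻¹)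
    (w' := fun u => ((T - u) ^ 2)⁻¹) hx
    (ContinuousOn.inv₀ (by fun_prop) fun u hu => pow_ne_zero 2 (hne u hu))
    (fun u hu => by
      have := ((hasDerivAt_id u).const_sub T).inv (hne u hu)
      exact this.congr_deriv (by simp))
  have e : (fun u => x u / (T - u)) = fun u => (T - u)⁻¹ * x u := by
    ext u; rw [div_eq_inv_mul]
  rw [e, this.youngIntegral_eq, hx0]
  simp only [div_eq_mul_inv]
  ring_nf

end Bridge

/-! ### Behaviour of a single path near the terminal time. -/

section Asymptotics

variable {T α h : ℝ} {b x : ℝ → ℝ}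

theorem HolderOn.abs_le {f : ℝ → ℝ} (hT : 0 < T) (hh : 0 < h) (hf : HolderOn f h (Ico 0 T)) :
    ∃ M, 0 ≤ M ∧ ∀ u ∈ Ico 0 T, |f u| ≤ M := by
  obtain ⟨C, hC, H⟩ := hf
  refine ⟨|f 0| + C * T ^ h, by positivity, fun u hu => ?_⟩
  have h1 := H u hu 0 ⟨le_rfl, hT⟩
  have h2 : |u - 0| ^ h ≤ T ^ h := by
    rw [sub_zero, abs_of_nonneg hu.1]
    exact Real.rpow_le_rpow hu.1 hu.2.le hh.le
  have h3 := abs_sub_abs_le_abs_sub (f u) (f 0)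
  nlinarith

theorem integral_sq_pos (hx : ContinuousOn x (Ico 0 T)) {t s : ℝ} (ht : t < T)
    (hs : s ∈ Icc 0 t) (hs0 : 0 < t) (hne : x s ≠ 0) :
    0 < ∫ u in (0 : ℝ)..t, x u ^ 2 / (T - u) ^ 2 := by
  have hc := ((integrand_continuousOn hx).mono (Icc_subset_Ico_of_lt ht)).pow 2
  simp only [← div_pow]
  refine intervalIntegral.integral_pos hs0 hc (fun u _ => sq_nonneg _) ⟨s, hs, ?_⟩
  have : T - s ≠ 0 := (sub_pos.2 (hs.2.trans_lt ht)).ne'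
  positivity

theorem integral_sq_mono (hx : ContinuousOn x (Ico 0 T)) {s t : ℝ} (hs : 0 ≤ s) (hst : s ≤ t)
    (ht : t < T) :
    ∫ u in (0 : ℝ)..s, x u ^ 2 / (T - u) ^ 2 ≤ ∫ u in (0 : ℝ)..t, x u ^ 2 / (T - u) ^ 2 := by
  have hc := ((integrand_continuousOn hx).mono (Icc_subset_Ico_of_lt ht)).pow 2
  simp only [← div_pow]
  refine intervalIntegral.integral_mono_interval le_rfl hs hst ?_
    (hc.intervalIntegrable_of_Icc (hs.trans hst))
  exact Eventually.of_forall fun u => sq_nonneg _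

theorem exists_ne_zero_of_driver_ne_zero
    (heq : ∀ t ∈ Ico (0 : ℝ) T, x t = -α * (∫ u in (0 : ℝ)..t, x u / (T - u)) + b t)
    {t : ℝ} (ht : t ∈ Ico 0 T) (hb : b t ≠ 0) : ∃ s ∈ Icc 0 t, x s ≠ 0 := by
  by_contra! H
  have h1 : ∫ u in (0 : ℝ)..t, x u / (T - u) = 0 := by
    rw [intervalIntegral.integral_congr (g := fun _ => 0)]
    · simp
    · intro u hu
      rw [uIcc_of_le ht.1] at hu
      simp [H u hu]
  have h2 := heq t ht
  rw [h1, H t ⟨ht.1, le_rfl⟩] at h2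
  simp at h2
  exact hb h2.symm

/-- When the drift is strong, the bridge decays at the Hölder rate of the driver. -/
theorem abs_bridge_le (hT : 0 < T) (hh : 0 < h) (hhα : h < α)
    (hx : ContinuousOn x (Ico 0 T))
    (heq : ∀ t ∈ Ico (0 : ℝ) T, x t = -α * (∫ u in (0 : ℝ)..t, x u / (T - u)) + b t)
    (hb : HolderOn b h (Ico 0 T)) :
    ∃ K, ∀ t ∈ Ico 0 T, |x t| ≤ K * (T - t) ^ h := by
  obtain ⟨M, hM0, hM⟩ := hb.abs_le hT hh
  obtain ⟨C, hC, H⟩ := hb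
  have hα : 0 < α := hh.trans hhα
  refine ⟨M * T ^ (-α) * T ^ (α - h) + α * (C / (α - h)), fun t ht => ?_⟩
  have h0 : 0 < T - t := sub_pos.2 ht.2
  have hlt : Icc 0 t ⊆ Iio T := fun u hu => hu.2.trans_lt ht.2
  -- With `c = b t` the integrand is at most `C * (T - u) ^ (h - α - 1)`, whose integral blows up
  -- like `(T - t) ^ (h - α)`; the prefactor `(T - t) ^ α` leaves `(T - t) ^ h`.
  rw [bridge_eq_sub_const hx heq ht (b t), sub_self, zero_add]
  have hint : |∫ u in (0 : ℝ)..t, (T - u) ^ (-α - 1) * (b u - b t)| ≤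
      C / (α - h) * (T - t) ^ (h - α) := by
    have h1 : |∫ u in (0 : ℝ)..t, (T - u) ^ (-α - 1) * (b u - b t)| ≤
        ∫ u in (0 : ℝ)..t, C * (T - u) ^ (h - α - 1) := by
      rw [← Real.norm_eq_abs]
      refine intervalIntegral.norm_integral_le_of_norm_le ht.1
        (Eventually.of_forall fun u hu => ?_) ?_
      · have hu0 : 0 < T - u := sub_pos.2 (hu.2.trans_lt ht.2)
        rw [norm_mul, Real.norm_eq_abs, Real.norm_eq_abs, abs_of_pos (Real.rpow_pos_of_pos hu0 _),
          show h - α - 1 = (-α - 1) + h by ring, Real.rpow_add hu0, mul_left_comm]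
        gcongr
        refine (H u ⟨hu.1.le, hu.2.trans_lt ht.2⟩ t ht).trans ?_
        gcongr
        rw [abs_le]; constructor <;> linarith [hu.2, ht.2]
      · exact (continuousOn_const.mul ((continuousOn_sub_rpow T _).mono
          hlt)).intervalIntegrable_of_Icc ht.1
    rw [intervalIntegral.integral_const_mul] at h1
    have h2 := mul_integral_sub_rpow ht (h - α)
    have hp : 0 < α - h := sub_pos.2 hhα
    have h3 : ∫ u in (0 : ℝ)..t, (T - u) ^ (h - α - 1) ≤ (T - t) ^ (h - α) / (α - h) := by
      rw [le_div_iff₀ hp]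
      have : 0 < T ^ (h - α) := Real.rpow_pos_of_pos hT _
      linarith
    calc _ ≤ _ := h1
      _ ≤ C * ((T - t) ^ (h - α) / (α - h)) := by gcongr
      _ = _ := by ring
  have hA : (T - t) ^ α ≤ T ^ (α - h) * (T - t) ^ h := by
    calc (T - t) ^ α = (T - t) ^ (α - h) * (T - t) ^ h := by rw [← Real.rpow_add h0]; ring_nf
      _ ≤ _ := by
        gcongr
        all_goals linarith [ht.1]
  have hB : (T - t) ^ α * (T - t) ^ (h - α) = (T - t) ^ h := by
    rw [← Real.rpow_add h0]; ring_nf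
  have hTα : 0 < T ^ (-α) := Real.rpow_pos_of_pos hT _
  have hTt : 0 < (T - t) ^ α := Real.rpow_pos_of_pos h0 _
  calc _ ≤ |b t * T ^ (-α) * (T - t) ^ α| +
        |α * (T - t) ^ α * ∫ u in (0 : ℝ)..t, (T - u) ^ (-α - 1) * (b u - b t)| := abs_sub _ _
    _ ≤ M * T ^ (-α) * (T ^ (α - h) * (T - t) ^ h) +
        α * (T - t) ^ α * (C / (α - h) * (T - t) ^ (h - α)) := by
      rw [abs_mul, abs_mul, abs_mul, abs_mul, abs_of_pos hTα, abs_of_pos hTt, abs_of_pos hα]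
      gcongr
      exact hM t ht
    _ = M * T ^ (-α) * (T ^ (α - h) * (T - t) ^ h) +
        α * (C / (α - h)) * ((T - t) ^ α * (T - t) ^ (h - α)) := by ring
    _ = _ := by rw [hB]; ring

theorem tendsto_sub_rpow_zero {p : ℝ} (hp : 0 < p) :
    Tendsto (fun t => (T - t) ^ p) (𝓝[<] T) (𝓝 0) := by
  have : ContinuousAt (fun t => (T - t) ^ p) T :=
    ContinuousAt.rpow_const (by fun_prop) (Or.inr hp.le)
  have h2 := this.tendsto
  rw [sub_self, Real.zero_rpow hp.ne'] at h2
  exact h2.mono_left nhdsWithin_le_nhds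

/-- The distance to `1 / 2` is `x t ^ 2 / (T - t)` over twice the denominator. The former is `O((T -
t) ^ (2 * h - 1))`; the latter is monotone in `t`, and positive from `s` on because a path vanishing
on `[0, s]` would force `b s = 0`. -/
theorem tendsto_half_sub_div_of_strong_drift (hT : 0 < T) (hh : 1 / 2 < h) (hhα : h < α)
    (hx : ContinuousOn x (Ico 0 T))
    (heq : ∀ t ∈ Ico (0 : ℝ) T, x t = -α * (∫ u in (0 : ℝ)..t, x u / (T - u)) + b t)
    (hb : HolderOn b h (Ico 0 T)) {s : ℝ} (hs : s ∈ Ioo 0 T) (hbs : b s ≠ 0) :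
    Tendsto (fun t => -((x t ^ 2 / (T - t) - ∫ u in (0 : ℝ)..t, x u ^ 2 / (T - u) ^ 2) / 2) /
        ∫ u in (0 : ℝ)..t, x u ^ 2 / (T - u) ^ 2) (𝓝[<] T) (𝓝 (1 / 2)) := by
  obtain ⟨K, hK⟩ := abs_bridge_le hT (by linarith) hhα hx heq hb
  obtain ⟨r, hr, hxr⟩ := exists_ne_zero_of_driver_ne_zero heq ⟨hs.1.le, hs.2⟩ hbs
  have hD := integral_sq_pos hx hs.2 hr hs.1 hxr
  set D := ∫ u in (0 : ℝ)..s, x u ^ 2 / (T - u) ^ 2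
  have hlim : Tendsto (fun t => K ^ 2 * (T - t) ^ (2 * h - 1) / (2 * D)) (𝓝[<] T) (𝓝 0) := by
    simpa using ((tendsto_sub_rpow_zero (T := T) (p := 2 * h - 1) (by linarith)).const_mul
      (K ^ 2)).div_const (2 * D)
  rw [tendsto_iff_dist_tendsto_zero]
  refine squeeze_zero' (Eventually.of_forall fun _ => dist_nonneg) ?_ hlim
  filter_upwards [Ioo_mem_nhdsLT hs.2] with t ht
  have h0 : 0 < T - t := sub_pos.2 ht.2
  have hDt := integral_sq_mono hx hs.1.le ht.1.le ht.2
  set E := ∫ u in (0 : ℝ)..t, x u ^ 2 / (T - u) ^ 2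
  have hE : 0 < E := hD.trans_le hDt
  have hxt := hK t ⟨(hs.1.trans ht.1).le, ht.2⟩
  have h1 : x t ^ 2 / (T - t) ≤ K ^ 2 * (T - t) ^ (2 * h - 1) := by
    rw [div_le_iff₀ h0]
    calc x t ^ 2 = |x t| ^ 2 := (sq_abs _).symm
      _ ≤ (K * (T - t) ^ h) ^ 2 := by gcongr
      _ = K ^ 2 * ((T - t) ^ (2 * h - 1) * (T - t)) := by
        rw [← Real.rpow_add_one h0.ne', mul_pow,
          ← Real.rpow_natCast ((T - t) ^ h), ← Real.rpow_mul h0.le]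
        congr 2; push_cast; ring
      _ = _ := by ring
  rw [Real.dist_eq]
  have e : -((x t ^ 2 / (T - t) - E) / 2) / E - 1 / 2 = -(x t ^ 2 / (T - t) / (2 * E)) := by
    field_simp; ring
  have h2 : 0 ≤ x t ^ 2 / (T - t) := by positivity
  rw [e, abs_neg, abs_of_nonneg (by positivity)]
  gcongr

/-- A weighted Cesàro lemma. -/
theorem tendsto_integral_mul_div {f g : ℝ → ℝ} {l : ℝ}
    (hf : ContinuousOn f (Ico 0 T)) (hg : ContinuousOn g (Ico 0 T))
    (hg0 : ∀ u ∈ Ico 0 T, 0 ≤ g u)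
    (hG : Tendsto (fun t => ∫ u in (0 : ℝ)..t, g u) (𝓝[<] T) atTop)
    (hl : Tendsto f (𝓝[<] T) (𝓝 l)) (hT : 0 < T) :
    Tendsto (fun t => (∫ u in (0 : ℝ)..t, g u * f u) / ∫ u in (0 : ℝ)..t, g u)
      (𝓝[<] T) (𝓝 l) := by
  rw [Metric.tendsto_nhds]
  intro ε hε
  -- Beyond `r > s` the deviation of `f` from `l` is below `ε / 2`; the part before `r` is a
  -- constant, absorbed by the divergence of the total weight.
  obtain ⟨s, hsT, hs⟩ := (mem_nhdsLT_iff_exists_Ioo_subset' hT).1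
    ((Metric.tendsto_nhds.1 hl (ε / 2) (half_pos hε)))
  have hr : max s 0 < T := max_lt hsT hT
  obtain ⟨r, hr1, hrT⟩ := exists_between hr
  have hr0 : 0 < r := (le_max_right _ _).trans_lt hr1
  have hsr : s < r := (le_max_left _ _).trans_lt hr1
  set A := |∫ u in (0 : ℝ)..r, g u * (f u - l)|
  filter_upwards [hG.eventually_gt_atTop 0, hG.eventually_gt_atTop (A / (ε / 2)),
    Ioo_mem_nhdsLT hrT] with t ht0 ht1 ht
  have hsub := Icc_subset_Ico_of_lt ht.2
  have hgi : ∀ u v, u ∈ Icc 0 t → v ∈ Icc 0 t → IntervalIntegrable g volume u v :=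
    fun u v hu hv => ((hg.mono hsub).mono (uIcc_subset_Icc hu hv)).intervalIntegrable
  have hgc : ContinuousOn (fun u => g u * (f u - l)) (Ico 0 T) := hg.mul (hf.sub continuousOn_const)
  have hgf : ∀ u v, u ∈ Icc 0 t → v ∈ Icc 0 t →
      IntervalIntegrable (fun u => g u * (f u - l)) volume u v :=
    fun u v hu hv => ((hgc.mono hsub).mono (uIcc_subset_Icc hu hv)).intervalIntegrable
  have m0 : (0 : ℝ) ∈ Icc 0 t := ⟨le_rfl, (hr0.trans ht.1).le⟩
  have mr : r ∈ Icc 0 t := ⟨hr0.le, ht.1.le⟩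
  have mt : t ∈ Icc 0 t := ⟨(hr0.trans ht.1).le, le_rfl⟩
  set G := ∫ u in (0 : ℝ)..t, g u with hGdef
  have e1 : (∫ u in (0 : ℝ)..t, g u * f u) = (∫ u in (0 : ℝ)..t, g u * (f u - l)) + G * l := by
    rw [hGdef, ← intervalIntegral.integral_mul_const,
      ← intervalIntegral.integral_add (hgf _ _ m0 mt) ((hgi _ _ m0 mt).mul_const l)]
    congr 1; ext u; ring
  have e2 : (∫ u in (0 : ℝ)..t, g u * (f u - l)) =
      (∫ u in (0 : ℝ)..r, g u * (f u - l)) + ∫ u in r..t, g u * (f u - l) :=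
    (intervalIntegral.integral_add_adjacent_intervals (hgf _ _ m0 mr) (hgf _ _ mr mt)).symm
  have e3 : |∫ u in r..t, g u * (f u - l)| ≤ ε / 2 * G := by
    have h1 : |∫ u in r..t, g u * (f u - l)| ≤ ∫ u in r..t, ε / 2 * g u := by
      rw [← Real.norm_eq_abs]
      refine intervalIntegral.norm_integral_le_of_norm_le ht.1.le
        (Eventually.of_forall fun u hu => ?_) ((hgi _ _ mr mt).const_mul _)
      have hu' : u ∈ Ico 0 T := ⟨hr0.le.trans hu.1.le, hu.2.trans_lt ht.2⟩
      have h2 : |f u - l| < ε / 2 := hs ⟨hsr.trans hu.1, hu'.2⟩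
      rw [norm_mul, Real.norm_eq_abs, Real.norm_eq_abs, abs_of_nonneg (hg0 u hu'), mul_comm]
      exact mul_le_mul_of_nonneg_right h2.le (hg0 u hu')
    rw [intervalIntegral.integral_const_mul] at h1
    refine h1.trans (mul_le_mul_of_nonneg_left ?_ (half_pos hε).le)
    rw [hGdef, ← intervalIntegral.integral_add_adjacent_intervals (hgi _ _ m0 mr) (hgi _ _ mr mt)]
    have : 0 ≤ ∫ u in (0 : ℝ)..r, g u :=
      intervalIntegral.integral_nonneg hr0.le fun u hu => hg0 u ⟨hu.1, hu.2.trans_lt hrT⟩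
    linarith
  have e4 : (∫ u in (0 : ℝ)..t, g u * f u) / G - l = (∫ u in (0 : ℝ)..t, g u * (f u - l)) / G := by
    rw [e1]; field_simp; ring
  rw [Real.dist_eq, e4, abs_div, abs_of_pos ht0, div_lt_iff₀ ht0, e2]
  rw [div_lt_iff₀ (half_pos hε)] at ht1
  calc _ ≤ A + _ := abs_add_le _ _
    _ < ε * G := by linarith

theorem HolderOn.exists_tendsto {f : ℝ → ℝ} (hT : 0 < T) (hh : 0 < h)
    (hf : HolderOn f h (Ico 0 T)) : ∃ l, Tendsto f (𝓝[<] T) (𝓝 l) := by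
  obtain ⟨C, hC, H⟩ := hf
  refine cauchy_map_iff_exists_tendsto.1 (Metric.cauchy_iff.2 ⟨inferInstance, fun ε hε => ?_⟩)
  have hlim : Tendsto (fun t => C * (T - t) ^ h) (𝓝[<] T) (𝓝 0) := by
    simpa using (tendsto_sub_rpow_zero hh).const_mul C
  obtain ⟨s, hs, hs1⟩ := ((hlim.eventually (gt_mem_nhds hε)).and (Ioo_mem_nhdsLT hT)).exists
  refine ⟨f '' Ioo s T, image_mem_map (Ioo_mem_nhdsLT hs1.2), ?_⟩
  rintro _ ⟨u, hu, rfl⟩ _ ⟨v, hv, rfl⟩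
  rw [Real.dist_eq]
  refine lt_of_le_of_lt ((H u ⟨(hs1.1.trans hu.1).le, hu.2⟩ v ⟨(hs1.1.trans hv.1).le, hv.2⟩).trans
    ?_) hs
  gcongr
  rw [_root_.abs_le]; constructor <;> linarith [hu.1, hu.2, hv.1, hv.2]

/-- When the drift is weaker than the Hölder regularity, the normalized bridge converges. -/
theorem exists_tendsto_normalized_bridge (hT : 0 < T) (hα : 0 < α) (hαh : α < h)
    (hx : ContinuousOn x (Ico 0 T))
    (heq : ∀ t ∈ Ico (0 : ℝ) T, x t = -α * (∫ u in (0 : ℝ)..t, x u / (T - u)) + b t)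
    (hb : HolderOn b h (Ico 0 T)) :
    ∃ l, Tendsto (fun t => (T - t) ^ (-α) * x t) (𝓝[<] T) (𝓝 l) := by
  have hh : 0 < h := hα.trans hαh
  have hbc := hb.continuousOn hh
  obtain ⟨L, hL⟩ := hb.exists_tendsto hT hh
  obtain ⟨C, hC, H⟩ := hb
  have hbL : ∀ u ∈ Ico 0 T, |b u - L| ≤ C * (T - u) ^ h := by
    intro u hu
    have h1 : Tendsto (fun t => |b u - b t|) (𝓝[<] T) (𝓝 |b u - L|) :=
      (tendsto_const_nhds.sub hL).abs
    refine le_of_tendsto h1 ?_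
    filter_upwards [Ioo_mem_nhdsLT hu.2] with t ht
    refine (H u hu t ⟨hu.1.trans ht.1.le, ht.2⟩).trans ?_
    gcongr
    rw [abs_le]; constructor <;> linarith [ht.1, ht.2]
  -- The dominating power `h - α - 1` exceeds `-1` exactly because `α < h`.
  have hint : IntegrableOn (fun u => (T - u) ^ (-α - 1) * (b u - L)) (Ioo 0 T) := by
    have hdom : IntegrableOn (fun u => C * (T - u) ^ (h - α - 1)) (Ioo 0 T) := by
      have h1 : IntervalIntegrable (fun u : ℝ => u ^ (h - α - 1)) volume 0 T :=
        intervalIntegral.intervalIntegrable_rpow' (by linarith)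
      have h2 := (h1.comp_sub_left T).const_mul C
      rw [sub_zero, sub_self] at h2
      exact ((intervalIntegrable_iff_integrableOn_Ioo_of_le hT.le).1 h2.symm)
    refine Integrable.mono' hdom ?_ ?_
    · refine ContinuousOn.aestronglyMeasurable ?_ measurableSet_Ioo
      exact ((continuousOn_sub_rpow T _).mono fun u hu => hu.2).mul
        ((hbc.mono Ioo_subset_Ico_self).sub continuousOn_const)
    · filter_upwards [ae_restrict_mem measurableSet_Ioo] with u hu
      have hu0 : 0 < T - u := sub_pos.2 hu.2
      rw [norm_mul, Real.norm_eq_abs, Real.norm_eq_abs, abs_of_pos (Real.rpow_pos_of_pos hu0 _),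
          show h - α - 1 = (-α - 1) + h by ring, Real.rpow_add hu0, mul_left_comm]
      gcongr
      exact hbL u ⟨hu.1.le, hu.2⟩
  have hlim : Tendsto (fun t => ∫ u in (0 : ℝ)..t, (T - u) ^ (-α - 1) * (b u - L)) (𝓝[<] T)
      (𝓝 (∫ u in (0 : ℝ)..T, (T - u) ^ (-α - 1) * (b u - L))) := by
    have h1 := intervalIntegral.continuousOn_primitive_interval (a := 0) (b := T) (μ := volume)
      (f := fun u => (T - u) ^ (-α - 1) * (b u - L)) (by
        rw [uIcc_of_le hT.le]; exact (integrableOn_Icc_iff_integrableOn_Ioo).2 hint)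
    rw [uIcc_of_le hT.le] at h1
    have h2 := (h1 T ⟨hT.le, le_rfl⟩).tendsto
    refine h2.mono_left ?_
    rw [← nhdsWithin_Ioo_eq_nhdsLT hT]
    exact nhdsWithin_mono _ Ioo_subset_Icc_self
  have hlim2 : Tendsto (fun t => (T - t) ^ (-α) * (b t - L)) (𝓝[<] T) (𝓝 0) := by
    have h3 : Tendsto (fun t => C * (T - t) ^ (h - α)) (𝓝[<] T) (𝓝 0) := by
      simpa using (tendsto_sub_rpow_zero (T := T) (sub_pos.2 hαh)).const_mul C
    refine squeeze_zero_norm' ?_ h3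
    filter_upwards [Ioo_mem_nhdsLT hT] with t ht
    have ht0 : 0 < T - t := sub_pos.2 ht.2
    rw [norm_mul, Real.norm_eq_abs, Real.norm_eq_abs, abs_of_pos (Real.rpow_pos_of_pos ht0 _),
      show h - α = -α + h by ring, Real.rpow_add ht0, mul_left_comm]
    gcongr
    exact hbL t ⟨ht.1.le, ht.2⟩
  refine ⟨_, ((hlim2.add_const (L * T ^ (-α))).sub (hlim.const_mul α)).congr' ?_⟩
  filter_upwards [Ioo_mem_nhdsLT hT] with t ht
  have ht0 : 0 < T - t := sub_pos.2 ht.2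
  have h1 : (T - t) ^ (-α) * (T - t) ^ α = 1 := by rw [← Real.rpow_add ht0]; simp
  rw [bridge_eq_sub_const hx heq ⟨ht.1.le, ht.2⟩ L]
  linear_combination (α * (∫ u in (0 : ℝ)..t, (T - u) ^ (-α - 1) * (b u - L)) - L * T ^ (-α)) * h1

/-- Since `p ≤ 0`, the integrand dominates `T ^ p / (T - u)`, whose integral diverges
logarithmically; the borderline `p = 0` needs no separate treatment. -/
theorem tendsto_integral_sub_rpow_atTop (hT : 0 < T) {p : ℝ} (hp : p ≤ 0) :
    Tendsto (fun t => ∫ u in (0 : ℝ)..t, (T - u) ^ (p - 1)) (𝓝[<] T) atTop := by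
  have hlog : Tendsto (fun t => T ^ p * (Real.log T - Real.log (T - t))) (𝓝[<] T) atTop := by
    refine Tendsto.const_mul_atTop (Real.rpow_pos_of_pos hT p) ?_
    refine tendsto_atTop_add_const_left _ _ (tendsto_neg_atBot_atTop.comp ?_)
    refine Real.tendsto_log_nhdsGT_zero.comp ?_
    refine tendsto_nhdsWithin_iff.2 ⟨?_, ?_⟩
    · have : Tendsto (fun t => T - t) (𝓝 T) (𝓝 (T - T)) := by
        exact tendsto_const_nhds.sub tendsto_id
      rw [sub_self] at this
      exact this.mono_left nhdsWithin_le_nhds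
    · filter_upwards [self_mem_nhdsWithin] with t ht
      exact sub_pos.2 (mem_Iio.1 ht)
  refine tendsto_atTop_mono' _ ?_ hlog
  filter_upwards [Ioo_mem_nhdsLT hT] with t ht
  have hlt : Icc 0 t ⊆ Iio T := fun u hu => hu.2.trans_lt ht.2
  have hne : ∀ u ∈ Icc 0 t, T - u ≠ 0 := fun u hu => (sub_pos.2 (hlt hu)).ne'
  have hi : IntervalIntegrable (fun u => (T - u)⁻¹) volume 0 t :=
    (ContinuousOn.inv₀ (by fun_prop) hne).intervalIntegrable_of_Icc ht.1.le
  have e : Real.log T - Real.log (T - t) = ∫ u in (0 : ℝ)..t, (T - u)⁻¹ := by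
    rw [intervalIntegral.integral_eq_sub_of_hasDerivAt (f := fun u => -Real.log (T - u))
      (fun u hu => ?_) hi]
    · rw [sub_zero]; ring
    · rw [uIcc_of_le ht.1.le] at hu
      have := (((hasDerivAt_id u).const_sub T).log (hne u hu)).neg
      exact this.congr_deriv (by simp [neg_div])
  rw [e, ← intervalIntegral.integral_const_mul]
  refine intervalIntegral.integral_mono_on ht.1.le (hi.const_mul _)
    (((continuousOn_sub_rpow T _).mono hlt).intervalIntegrable_of_Icc ht.1.le) fun u hu => ?_
  have hu0 : 0 < T - u := sub_pos.2 (hlt hu)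
  rw [Real.rpow_sub_one hu0.ne', div_eq_mul_inv]
  refine mul_le_mul_of_nonneg_right ?_ (inv_nonneg.2 hu0.le)
  exact Real.rpow_le_rpow_of_nonpos hu0 (sub_le_self T hu.1) hp

/-- With `p = 2 * α - 1` and `f` the square of the normalized path, the denominator is the integral
of `(T - u) ^ (p - 1) * f u` and `x t ^ 2 / (T - t)` is `(T - t) ^ p * f t`. The limit `l ^ 2` of
`f` cancels from the quotient, leaving `-p`, and `(1 + p) / 2 = α`. -/
theorem tendsto_half_sub_div_of_weak_drift (hT : 0 < T) (hα : α ≤ 1 / 2)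
    (hx : ContinuousOn x (Ico 0 T)) {l : ℝ} (hl : l ≠ 0)
    (hlim : Tendsto (fun t => (T - t) ^ (-α) * x t) (𝓝[<] T) (𝓝 l)) :
    Tendsto (fun t => -((x t ^ 2 / (T - t) - ∫ u in (0 : ℝ)..t, x u ^ 2 / (T - u) ^ 2) / 2) /
        ∫ u in (0 : ℝ)..t, x u ^ 2 / (T - u) ^ 2) (𝓝[<] T) (𝓝 α) := by
  set f : ℝ → ℝ := fun t => ((T - t) ^ (-α) * x t) ^ 2 with hf
  set p := 2 * α - 1 with hp
  have hfc : ContinuousOn f (Ico 0 T) :=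
    (((continuousOn_sub_rpow T _).mono fun u hu => hu.2).mul hx).pow 2
  have hgc : ContinuousOn (fun u : ℝ => (T - u) ^ (p - 1)) (Ico 0 T) :=
    (continuousOn_sub_rpow T _).mono fun u hu => hu.2
  have hG := tendsto_integral_sub_rpow_atTop hT (show p ≤ 0 by linarith)
  have hfl : Tendsto f (𝓝[<] T) (𝓝 (l ^ 2)) := hlim.pow 2
  have hces := tendsto_integral_mul_div hfc hgc
    (fun u hu => Real.rpow_nonneg (sub_pos.2 hu.2).le _) hG hfl hT
  have hl2 : l ^ 2 ≠ 0 := pow_ne_zero 2 hl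
  -- By `mul_integral_sub_rpow` this is `(T - t) ^ p` divided by the integral of the weight.
  have hy : Tendsto (fun t => T ^ p / (∫ u in (0 : ℝ)..t, (T - u) ^ (p - 1)) - p) (𝓝[<] T)
      (𝓝 (0 - p)) := (hG.const_div_atTop (T ^ p)).sub_const p
  have hall := ((hy.mul hfl).div hces hl2).const_sub 1 |>.div_const 2
  have hval : (1 - (0 - p) * l ^ 2 / l ^ 2) / 2 = α := by
    rw [mul_div_cancel_right₀ _ hl2, hp]; ring
  rw [hval] at hall
  refine hall.congr' ?_
  filter_upwards [Ioo_mem_nhdsLT hT, hG.eventually_gt_atTop 0,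
    (hces.eventually_ne hl2)] with t ht hG0 hR0
  have ht0 : 0 < T - t := sub_pos.2 ht.2
  have hp' : ∀ u ∈ Icc 0 t, (T - u) ^ (p - 1) * f u = x u ^ 2 / (T - u) ^ 2 := by
    intro u hu
    have hu0 : 0 < T - u := sub_pos.2 (hu.2.trans_lt ht.2)
    simp only [hf]
    rw [mul_pow, ← Real.rpow_natCast ((T - u) ^ (-α)), ← Real.rpow_mul hu0.le, ← mul_assoc,
      ← Real.rpow_add hu0, show p - 1 + -α * ((2 : ℕ) : ℝ) = -((2 : ℕ) : ℝ) by
        rw [hp]; push_cast; ring, Real.rpow_neg hu0.le, Real.rpow_natCast]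
    rw [div_eq_mul_inv, mul_comm]
  have e1 : ∫ u in (0 : ℝ)..t, (T - u) ^ (p - 1) * f u =
      ∫ u in (0 : ℝ)..t, x u ^ 2 / (T - u) ^ 2 := by
    refine intervalIntegral.integral_congr fun u hu => hp' u ?_
    rwa [uIcc_of_le ht.1.le] at hu
  have e2 : x t ^ 2 / (T - t) = (T - t) ^ p * f t := by
    have := hp' t ⟨ht.1.le, le_rfl⟩
    rw [Real.rpow_sub_one ht0.ne'] at this
    field_simp at this ⊢
    linarith
  have e3 := mul_integral_sub_rpow ⟨ht.1.le, ht.2⟩ p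
  rw [e1] at hR0
  simp only [Pi.div_apply]
  rw [e2, e1]
  set G := ∫ u in (0 : ℝ)..t, (T - u) ^ (p - 1)
  set D := ∫ u in (0 : ℝ)..t, x u ^ 2 / (T - u) ^ 2
  have hD : D ≠ 0 := fun h => hR0 (by rw [h, zero_div])
  have e4 : (T - t) ^ p = T ^ p - p * G := by linarith
  rw [e4]
  field_simp
  ring

end Asymptotics

/-! ### From dyadic increments to Hölder continuity. -/

/-- Chaining along dyadic points. -/
theorem holderOn_of_dyadic {T h K : ℝ} {f : ℝ → ℝ} (hT : 0 < T) (hh : 0 < h) (hK : 0 ≤ K)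
    (hf : ContinuousOn f (Ico 0 T))
    (H : ∀ n k : ℕ, k < 2 ^ n →
      |f (T * (k + 1 : ℕ) / 2 ^ n) - f (T * k / 2 ^ n)| ≤ K * ((1 / 2) ^ h) ^ n) :
    HolderOn f h (Ico 0 T) := by
  set ρ : ℝ := (1 / 2) ^ h with hρ
  have hρ0 : 0 < ρ := by positivity
  have hρ1 : ρ < 1 := Real.rpow_lt_one (by norm_num) (by norm_num) hh
  have step : ∀ (n k l : ℕ), k ≤ l → l ≤ k + 1 → l < 2 ^ n →
      |f (T * l / 2 ^ n) - f (T * k / 2 ^ n)| ≤ K * ρ ^ n := by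
    intro n k l h1 h2 h3
    rcases h1.eq_or_lt with rfl | h1
    · simp only [sub_self, abs_zero]; positivity
    · obtain rfl : l = k + 1 := by omega
      exact H n k (by omega)
  have hfl : ∀ s ∈ Ico 0 T, ∀ n : ℕ, ⌊s / T * 2 ^ n⌋₊ < 2 ^ n := by
    intro s hs n
    have h0 : 0 ≤ s / T := div_nonneg hs.1 hT.le
    rw [Nat.floor_lt (by positivity)]
    push_cast
    have : s / T < 1 := (div_lt_one hT).2 hs.2
    nlinarith [show (0 : ℝ) < 2 ^ n by positivity]
  -- The dyadic approximations of `s` from below move by at most one step per level, so their values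
  -- form a geometrically convergent chain; continuity of `f` identifies its limit as `f s`.
  have happ : ∀ s ∈ Ico 0 T, ∀ n : ℕ,
      |f (T * ⌊s / T * 2 ^ n⌋₊ / 2 ^ n) - f s| ≤ K * ρ ^ n / (1 - ρ) := by
    intro s hs
    have h0 : 0 ≤ s / T := div_nonneg hs.1 hT.le
    have hlim : Tendsto (fun n : ℕ => T * (⌊s / T * 2 ^ n⌋₊ : ℝ) / 2 ^ n) atTop (𝓝 s) := by
      have h1 := (tendsto_nat_floor_mul_div_atTop (R := ℝ) h0).comp
        (tendsto_pow_atTop_atTop_of_one_lt (r := (2 : ℝ)) (by norm_num))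
      have h2 := h1.const_mul T
      rw [mul_div_cancel₀ s hT.ne'] at h2
      refine h2.congr fun n => ?_
      simp only [Function.comp]
      ring
    have hmem : ∀ n : ℕ, T * (⌊s / T * 2 ^ n⌋₊ : ℝ) / 2 ^ n ∈ Ico 0 T := by
      intro n
      refine ⟨by positivity, ?_⟩
      have h3 : (⌊s / T * 2 ^ n⌋₊ : ℝ) < 2 ^ n := by exact_mod_cast hfl s hs n
      rw [div_lt_iff₀ (by positivity)]
      exact mul_lt_mul_of_pos_left h3 hT
    have hflim := (hf s hs).tendsto.comp (tendsto_nhdsWithin_iff.2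
      ⟨hlim, Eventually.of_forall hmem⟩)
    refine fun n => dist_le_of_le_geometric_of_tendsto ρ K hρ1 (fun m => ?_) hflim n
    simp only [Function.comp]
    rw [dist_comm, Real.dist_eq]
    set k := ⌊s / T * 2 ^ m⌋₊ with hk
    have e1 : T * (k : ℝ) / 2 ^ m = T * (2 * k : ℕ) / 2 ^ (m + 1) := by
      rw [pow_succ]; push_cast; field_simp
    have hy : 0 ≤ s / T * 2 ^ m := by positivity
    have h4 : (k : ℝ) ≤ s / T * 2 ^ m := Nat.floor_le hy
    have h5 : s / T * 2 ^ m < k + 1 := Nat.lt_floor_add_one _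
    rw [e1]
    refine (step (m + 1) (2 * k) _ ?_ ?_ (hfl s hs (m + 1))).trans ?_
    · refine Nat.le_floor ?_
      push_cast
      rw [pow_succ]; linarith
    · rw [← Nat.lt_succ_iff, Nat.floor_lt (by positivity)]
      push_cast
      rw [pow_succ]; linarith
    · gcongr K * ?_
      exact pow_le_pow_of_le_one hρ0.le hρ1.le (Nat.le_succ m)
  set A := K * (2 / (1 - ρ) + 1) with hA
  have hA0 : 0 ≤ A := by
    have : 0 < 1 - ρ := sub_pos.2 hρ1
    positivity
  have key : ∀ s ∈ Ico 0 T, ∀ t ∈ Ico 0 T, s < t →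
      |f t - f s| ≤ A * (2 / T) ^ h * |t - s| ^ h := by
    intro s hs t ht hst
    have hx0 : 0 < (t - s) / T := div_pos (sub_pos.2 hst) hT
    have hx1 : (t - s) / T ≤ 1 := (div_le_one hT).2 (by linarith [hs.1, ht.2])
    -- At the level with `2 ^ (-(n + 1)) < (t - s) / T ≤ 2 ^ (-n)` the approximations of `s` and `t`
    -- are equal or adjacent, and `2 ^ (-n)` is still comparable to `t - s`.
    obtain ⟨n, hn1, hn2⟩ := exists_nat_pow_near_of_lt_one hx0 hx1
      (by norm_num : (0 : ℝ) < 1 / 2) (by norm_num)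
    have hs0 : 0 ≤ s / T := div_nonneg hs.1 hT.le
    have ht0 : 0 ≤ t / T := div_nonneg ht.1 hT.le
    have hts : s / T ≤ t / T := by gcongr
    have hclose : t / T * 2 ^ n ≤ s / T * 2 ^ n + 1 := by
      rw [sub_div, one_div, inv_pow] at hn2
      have h2n : (0 : ℝ) < 2 ^ n := by positivity
      have := mul_le_mul_of_nonneg_right hn2 h2n.le
      rw [inv_mul_cancel₀ h2n.ne'] at this
      linarith
    have h1 := step n ⌊s / T * 2 ^ n⌋₊ ⌊t / T * 2 ^ n⌋₊ (Nat.floor_mono (by gcongr)) (by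
      rw [← Nat.floor_add_one (by positivity)]
      exact Nat.floor_mono hclose) (hfl t ht n)
    have h2 := happ s hs n
    have h3 := happ t ht n
    have h4 : |f t - f s| ≤ A * ρ ^ n := by
      have e : A * ρ ^ n = K * ρ ^ n / (1 - ρ) + K * ρ ^ n + K * ρ ^ n / (1 - ρ) := by
        rw [hA]; ring
      rw [e]
      rw [abs_le] at h1 h2 h3 ⊢
      constructor <;> linarith
    have h5 : ρ ^ n ≤ (2 / T) ^ h * |t - s| ^ h := by
      rw [hρ, ← Real.rpow_natCast, ← Real.rpow_mul (by norm_num), mul_comm h,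
        Real.rpow_mul (by norm_num), Real.rpow_natCast,
        ← Real.mul_rpow (by positivity) (abs_nonneg _)]
      refine Real.rpow_le_rpow (by positivity) ?_ hh.le
      rw [abs_of_pos (sub_pos.2 hst)]
      rw [pow_succ] at hn1
      have : 2 / T * (t - s) = 2 * ((t - s) / T) := by ring
      linarith
    calc _ ≤ _ := h4
      _ ≤ A * ((2 / T) ^ h * |t - s| ^ h) := by gcongr
      _ = _ := by ring
  refine ⟨A * (2 / T) ^ h, by positivity, fun u hu v hv => ?_⟩
  rcases lt_trichotomy u v with huv | rfl | huv
  · rw [abs_sub_comm, abs_sub_comm u v]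
    exact key u hu v hv huv
  · simp only [sub_self, abs_zero]; positivity
  · exact key v hv u hu huv

/-! ### Increments of fractional Brownian motion and Kolmogorov's criterion. -/

section Gaussian

variable {Ω : Type*} [MeasurableSpace Ω] {P : Measure Ω} {H T : ℝ} {B : ℝ → Ω → ℝ}

theorem IsFBM.memLp_two (hB : IsFBM P H T B) {t : ℝ} (ht : t ∈ Icc 0 T) : MemLp (B t) 2 P :=
  (hB.isGaussianProcess.hasGaussianLaw_eval ⟨t, ht⟩).memLp_two

theorem IsFBM.aemeasurable (hB : IsFBM P H T B) {t : ℝ} (ht : t ∈ Icc 0 T) :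
    AEMeasurable (B t) P :=
  (hB.isGaussianProcess.hasGaussianLaw_eval ⟨t, ht⟩).aemeasurable

theorem IsFBM.isProbabilityMeasure (hB : IsFBM P H T B) : IsProbabilityMeasure P :=
  hB.isGaussianProcess.isProbabilityMeasure

theorem IsFBM.integral_increment_mul (hB : IsFBM P H T B) {a b c d : ℝ} (ha : a ∈ Icc 0 T)
    (hb : b ∈ Icc 0 T) (hc : c ∈ Icc 0 T) (hd : d ∈ Icc 0 T) :
    ∫ ω, (B b ω - B a ω) * (B d ω - B c ω) ∂P =
      (|d - a| ^ (2 * H) + |c - b| ^ (2 * H) - |c - a| ^ (2 * H) - |d - b| ^ (2 * H)) / 2 := by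
  have hi : ∀ s ∈ Icc 0 T, ∀ t ∈ Icc 0 T, Integrable (fun ω => B s ω * B t ω) P :=
    fun s hs t ht => (hB.memLp_two hs).integrable_mul (hB.memLp_two ht)
  have e : ∀ ω, (B b ω - B a ω) * (B d ω - B c ω) =
      (B b ω * B d ω - B b ω * B c ω) - (B a ω * B d ω - B a ω * B c ω) := fun ω => by ring
  simp only [e]
  have h1 : Integrable (fun ω => B b ω * B d ω - B b ω * B c ω) P :=
    (hi b hb d hd).sub (hi b hb c hc)
  have h2 : Integrable (fun ω => B a ω * B d ω - B a ω * B c ω) P :=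
    (hi a ha d hd).sub (hi a ha c hc)
  rw [integral_sub h1 h2, integral_sub (hi b hb d hd) (hi b hb c hc), integral_sub (hi a ha d hd) (hi a ha c hc),
    hB.covariance_eq _ hb _ hd, hB.covariance_eq _ hb _ hc, hB.covariance_eq _ ha _ hd,
    hB.covariance_eq _ ha _ hc]
  ring

/-- The increments of a fractional Brownian motion with `H ≥ 1 / 2` are positively correlated. -/
theorem IsFBM.integral_increment_mul_nonneg (hB : IsFBM P H T B) (hH : 1 / 2 ≤ H) {a b c d : ℝ}
    (ha : 0 ≤ a) (hab : a ≤ b) (hbc : b ≤ c) (hcd : c ≤ d) (hd : d ≤ T) :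
    0 ≤ ∫ ω, (B b ω - B a ω) * (B d ω - B c ω) ∂P := by
  rw [hB.integral_increment_mul ⟨ha, by linarith⟩ ⟨by linarith, by linarith⟩
    ⟨by linarith, by linarith⟩ ⟨by linarith, hd⟩, abs_of_nonneg (show 0 ≤ d - a by linarith),
    abs_of_nonneg (show 0 ≤ c - b by linarith), abs_of_nonneg (show 0 ≤ c - a by linarith),
    abs_of_nonneg (show 0 ≤ d - b by linarith)]
  rcases (show c - b ≤ d - a by linarith).eq_or_lt with h | h
  · have h1 : c - a = d - a := by linarith
    have h2 : d - b = c - b := by linarith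
    rw [h1, h2]; simp
  -- The lengths `c - a` and `d - b` lie between `c - b` and `d - a` and have the same sum, so
  -- convexity of the power `2 * H ≥ 1` compares the two pairs. The chord inequality is cleared of
  -- its denominator.
  have hcv := convexOn_rpow (p := 2 * H) (by linarith)
  have hpos : 0 < (d - a) - (c - b) := by linarith
  have key : ∀ z, c - b ≤ z → z ≤ d - a →
      z ^ (2 * H) * ((d - a) - (c - b)) ≤
        ((d - a) - z) * (c - b) ^ (2 * H) + (z - (c - b)) * (d - a) ^ (2 * H) := by
    intro z h1 h2
    have := hcv.2 (show c - b ∈ Ici (0 : ℝ) from sub_nonneg.2 hbc)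
      (show d - a ∈ Ici (0 : ℝ) from by simp only [mem_Ici]; linarith)
      (show 0 ≤ ((d - a) - z) / ((d - a) - (c - b)) from div_nonneg (by linarith) hpos.le)
      (show 0 ≤ (z - (c - b)) / ((d - a) - (c - b)) from div_nonneg (by linarith) hpos.le)
      (by rw [← add_div]; rw [div_eq_one_iff_eq hpos.ne']; ring)
    simp only [smul_eq_mul] at this
    have e : (d - a - z) / (d - a - (c - b)) * (c - b) +
        (z - (c - b)) / (d - a - (c - b)) * (d - a) = z := by
      field_simp; ring
    rw [e] at this
    calc _ ≤ _ := mul_le_mul_of_nonneg_right this hpos.le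
      _ = _ := by field_simp
  have k1 := key (c - a) (by linarith) (by linarith)
  have k2 := key (d - b) (by linarith) (by linarith)
  refine div_nonneg ?_ (by norm_num)
  refine nonneg_of_mul_nonneg_left (b := (d - a) - (c - b)) ?_ hpos
  nlinarith

theorem IsFBM.hasGaussianLaw_sum (hB : IsFBM P H T B) (n : ℕ) (c x : ℕ → ℝ)
    (hx : ∀ i ≤ n, x i ∈ Icc 0 T) :
    HasGaussianLaw (fun ω => ∑ i ∈ Finset.range n, c i * (B (x (i + 1)) ω - B (x i) ω)) P := by
  have h1 := hB.isGaussianProcess.hasGaussianLaw_increments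
    (t := fun i : Fin (n + 1) => (⟨x i, hx i (Nat.lt_succ_iff.1 i.2)⟩ : Icc 0 T))
  have h2 := h1.map_fun (∑ i : Fin n, c i • ContinuousLinearMap.proj (R := ℝ) (φ := fun _ => ℝ) i)
  refine h2.congr (Eventually.of_forall fun ω => ?_)
  simp [Finset.sum_range]

theorem IsFBM.integral_sum_eq_zero (hB : IsFBM P H T B) (n : ℕ) (c x : ℕ → ℝ)
    (hx : ∀ i ≤ n, x i ∈ Icc 0 T) :
    ∫ ω, ∑ i ∈ Finset.range n, c i * (B (x (i + 1)) ω - B (x i) ω) ∂P = 0 := by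
  have := hB.isProbabilityMeasure
  have hi : ∀ i ≤ n, Integrable (B (x i)) P := fun i h =>
    (hB.memLp_two (hx i h)).integrable (by norm_num)
  rw [integral_finsetSum]
  · refine Finset.sum_eq_zero fun i hi' => ?_
    rw [Finset.mem_range] at hi'
    rw [integral_const_mul, integral_sub (hi _ hi') (hi _ hi'.le), hB.mean_eq_zero _ (hx _ hi'),
      hB.mean_eq_zero _ (hx _ hi'.le), sub_zero, mul_zero]
  · intro i hi'
    rw [Finset.mem_range] at hi'
    exact ((hi _ hi').sub (hi _ hi'.le)).const_mul _

theorem IsFBM.map_sum (hB : IsFBM P H T B) (n : ℕ) (c x : ℕ → ℝ)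
    (hx : ∀ i ≤ n, x i ∈ Icc 0 T) :
    P.map (fun ω => ∑ i ∈ Finset.range n, c i * (B (x (i + 1)) ω - B (x i) ω)) =
      gaussianReal 0
        (∫ ω, (∑ i ∈ Finset.range n, c i * (B (x (i + 1)) ω - B (x i) ω)) ^ 2 ∂P).toNNReal := by
  have h := hB.hasGaussianLaw_sum n c x hx
  rw [h.map_eq_gaussianReal, variance_of_integral_eq_zero h.aemeasurable
    (hB.integral_sum_eq_zero n c x hx), hB.integral_sum_eq_zero n c x hx]

theorem IsFBM.integral_increment_sq (hB : IsFBM P H T B) (hH : 0 < H) {s t : ℝ}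
    (hs : s ∈ Icc 0 T) (ht : t ∈ Icc 0 T) :
    ∫ ω, (B t ω - B s ω) ^ 2 ∂P = |t - s| ^ (2 * H) := by
  simp only [pow_two]
  rw [hB.integral_increment_mul hs ht hs ht, abs_sub_comm s t, sub_self, sub_self, abs_zero,
    Real.zero_rpow (by linarith)]
  ring

theorem IsFBM.map_increment (hB : IsFBM P H T B) (hH : 0 < H) {s t : ℝ} (hs : s ∈ Icc 0 T)
    (ht : t ∈ Icc 0 T) :
    P.map (fun ω => B t ω - B s ω) = gaussianReal 0 (|t - s| ^ (2 * H)).toNNReal := by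
  have h := hB.map_sum 1 (fun _ => 1) (fun i => if i = 0 then s else t)
    (fun i _ => by split_ifs <;> assumption)
  simp only [Finset.range_one, Finset.sum_singleton, one_mul, zero_add, one_ne_zero, if_true,
    if_false] at h
  rw [h, hB.integral_increment_sq hH hs ht]

theorem IsFBM.lintegral_increment_pow (hB : IsFBM P H T B) (hH : 0 < H) (q : ℕ) {s t : ℝ}
    (hs : s ∈ Icc 0 T) (ht : t ∈ Icc 0 T) {c : ℝ} (hc : 0 ≤ c) :
    ∫⁻ ω, ENNReal.ofReal ((c * |B t ω - B s ω|) ^ q) ∂P =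
      ENNReal.ofReal ((∫ z, |z| ^ q ∂gaussianReal 0 1) * (c * |t - s| ^ H) ^ q) := by
  have hm : AEMeasurable (fun ω => B t ω - B s ω) P := (hB.aemeasurable ht).sub (hB.aemeasurable hs)
  have hsc : gaussianReal 0 (|t - s| ^ (2 * H)).toNNReal =
      (gaussianReal 0 1).map (fun z => |t - s| ^ H * z) := by
    rw [gaussianReal_map_const_mul, mul_zero, mul_one]
    congr 1
    ext
    rw [Real.coe_toNNReal _ (by positivity)]
    change _ = (|t - s| ^ H) ^ 2
    rw [← Real.rpow_natCast, ← Real.rpow_mul (abs_nonneg _), mul_comm]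
    norm_num
  have hmf : Measurable (fun y : ℝ => ENNReal.ofReal ((c * |y|) ^ q)) := by fun_prop
  have h1 : ∫⁻ ω, ENNReal.ofReal ((c * |B t ω - B s ω|) ^ q) ∂P =
      ∫⁻ z, ENNReal.ofReal (|z| ^ q * (c * |t - s| ^ H) ^ q) ∂gaussianReal 0 1 := by
    rw [← lintegral_map' (f := fun y : ℝ => ENNReal.ofReal ((c * |y|) ^ q)) hmf.aemeasurable hm,
      hB.map_increment hH hs ht, hsc, lintegral_map hmf (by fun_prop)]
    refine lintegral_congr fun z => ?_
    rw [abs_mul, abs_of_nonneg (show 0 ≤ |t - s| ^ H by positivity)]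
    congr 1
    ring
  have hint : Integrable (fun z : ℝ => |z| ^ q) (gaussianReal 0 1) :=
    (memLp_id_gaussianReal (μ := 0) (v := 1) q).integrable_norm_pow'
  rw [h1, ← integral_mul_const, ofReal_integral_eq_lintegral_ofReal (hint.mul_const _)]
  exact Eventually.of_forall fun z => by positivity

/-- Kolmogorov's continuity criterion for the fractional Brownian motion: the paths that are
continuous on `[0, T)` are Hölder continuous of any exponent smaller than `H`. -/
theorem IsFBM.ae_holderOn (hB : IsFBM P H T B) (hT : 0 < T) {h : ℝ} (hh : 0 < h) (hhH : h < H)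
    (hc : ∀ᵐ ω ∂P, ContinuousOn (fun t => B t ω) (Ico 0 T)) :
    ∀ᵐ ω ∂P, HolderOn (fun t => B t ω) h (Ico 0 T) := by
  have hH : 0 < H := hh.trans hhH
  -- Level `n` has `2 ^ n` increments, each contributing a moment of order `2 ^ (-n * q * (H - h))`
  -- after scaling by `2 ^ (h * n)`; the levels are summable once `q * (H - h) > 1`.
  obtain ⟨q, hq⟩ := exists_nat_gt (1 / (H - h))
  rw [div_lt_iff₀ (sub_pos.2 hhH)] at hq
  have hq0 : q ≠ 0 := by rintro rfl; norm_num at hq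
  set M := ∫ z, |z| ^ q ∂gaussianReal 0 1
  have hM : 0 ≤ M := integral_nonneg fun z => by positivity
  set c : ℕ → ℝ := fun n => (2 ^ h) ^ n with hcdef
  have hc0 : ∀ n, 0 < c n := fun n => by positivity
  set ρ : ℝ := 2 * ((2 : ℝ) ^ (h - H)) ^ q with hρ
  have hρ0 : 0 ≤ ρ := by positivity
  have hρ1 : ρ < 1 := by
    rw [hρ, ← Real.rpow_natCast, ← Real.rpow_mul (by norm_num)]
    nth_rewrite 1 [← Real.rpow_one 2]
    rw [← Real.rpow_add (by norm_num)]
    exact Real.rpow_lt_one_of_one_lt_of_neg (by norm_num) (by nlinarith)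
  have hmem : ∀ n k : ℕ, k ≤ 2 ^ n → T * k / 2 ^ n ∈ Icc 0 T := by
    intro n k hk
    refine ⟨by positivity, ?_⟩
    rw [div_le_iff₀ (by positivity)]
    have : (k : ℝ) ≤ 2 ^ n := by exact_mod_cast hk
    gcongr
  let F : ℕ → ℕ → Ω → ENNReal := fun n k ω => ENNReal.ofReal
    ((c n * |B (T * (k + 1 : ℕ) / 2 ^ n) ω - B (T * k / 2 ^ n) ω|) ^ q)
  have hFm : ∀ n, ∀ k ∈ Finset.range (2 ^ n), AEMeasurable (F n k) P := by
    intro n k hk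
    rw [Finset.mem_range] at hk
    have h1 := hB.aemeasurable (hmem n (k + 1) hk)
    have h2 := hB.aemeasurable (hmem n k hk.le)
    exact (((h1.sub h2).abs.const_mul (c n)).pow_const q).ennreal_ofReal
  have hF : ∀ n, ∀ k ∈ Finset.range (2 ^ n), ∫⁻ ω, F n k ω ∂P =
      ENNReal.ofReal (M * (T ^ H) ^ q * (((2 : ℝ) ^ (h - H)) ^ q) ^ n) := by
    intro n k hk
    rw [Finset.mem_range] at hk
    rw [hB.lintegral_increment_pow hH q (hmem n k hk.le) (hmem n (k + 1) hk) (hc0 n).le]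
    congr 1
    have e1 : |T * (k + 1 : ℕ) / 2 ^ n - T * k / 2 ^ n| = T / 2 ^ n := by
      rw [abs_of_nonneg]
      · push_cast; ring
      · push_cast; rw [← sub_div]; ring_nf; positivity
    rw [e1, hcdef, Real.div_rpow hT.le (by positivity), ← Real.rpow_natCast 2 n,
      ← Real.rpow_mul (by norm_num), mul_comm (n : ℝ), Real.rpow_mul (by norm_num),
      Real.rpow_natCast, Real.rpow_sub (by norm_num)]
    simp only [mul_pow, div_pow, ← pow_mul]
    rw [mul_comm n q]
    ring
  have hsum : ∫⁻ ω, ∑' n, ∑ k ∈ Finset.range (2 ^ n), F n k ω ∂P ≠ ⊤ := by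
    rw [lintegral_tsum fun n => Finset.aemeasurable_fun_sum _ (hFm n)]
    have e : ∀ n, ∫⁻ ω, ∑ k ∈ Finset.range (2 ^ n), F n k ω ∂P =
        ENNReal.ofReal (M * (T ^ H) ^ q * ρ ^ n) := by
      intro n
      rw [lintegral_finsetSum' _ (hFm n), Finset.sum_congr rfl (hF n), Finset.sum_const,
        Finset.card_range, nsmul_eq_mul, ← ENNReal.ofReal_natCast, ← ENNReal.ofReal_mul
        (by positivity)]
      congr 1
      rw [hρ, mul_pow]
      push_cast
      ring
    simp only [e]
    exact ((summable_geometric_of_lt_one hρ0 hρ1).mul_left _).tsum_ofReal_ne_top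
  have hae := ae_lt_top' (AEMeasurable.tsum fun n =>
    Finset.aemeasurable_fun_sum _ (hFm n)) hsum
  filter_upwards [hc, hae] with ω hω hS
  set S := ∑' n, ∑ k ∈ Finset.range (2 ^ n), F n k ω
  -- Every scaled increment to the power `q` is at most `S`. The maximum with `1` gives `S.toReal ≤
  -- K ^ q` and spares a `q`-th root.
  refine holderOn_of_dyadic (K := max 1 S.toReal) hT hh (by positivity) hω fun n k hk => ?_
  have h1 : F n k ω ≤ S :=
    (Finset.single_le_sum (f := fun k => F n k ω) (fun _ _ => zero_le)
      (Finset.mem_range.2 hk)).trans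
        (ENNReal.le_tsum (f := fun n => ∑ k ∈ Finset.range (2 ^ n), F n k ω) n)
  have h2 : (c n * |B (T * (k + 1 : ℕ) / 2 ^ n) ω - B (T * k / 2 ^ n) ω|) ^ q ≤
      (max 1 S.toReal) ^ q :=
    calc _ ≤ S.toReal := (ENNReal.ofReal_le_iff_le_toReal hS.ne).1 h1
      _ ≤ max 1 S.toReal := le_max_right _ _
      _ ≤ _ := le_self_pow₀ (le_max_left _ _) hq0
  have h3 := le_of_pow_le_pow_left₀ hq0 (by positivity) h2
  have e : ((1 / 2 : ℝ) ^ h) ^ n = (c n)⁻¹ := by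
    rw [hcdef, one_div, Real.inv_rpow (by norm_num), inv_pow]
  rw [e, ← div_eq_mul_inv, le_div_iff₀ (hc0 n), mul_comm]
  exact h3

end Gaussian

/-! ### The normalized bridge as a limit of Wiener sums. -/

theorem isTaggedPartition_uniform {t δ : ℝ} (ht : 0 ≤ t) (n : ℕ) (hδ : t / (n + 1 : ℕ) < δ) :
    IsTaggedPartition 0 t δ (n + 1) (fun i => i * (t / (n + 1 : ℕ)))
      (fun i => (i + 1 : ℕ) * (t / (n + 1 : ℕ))) := by
  have h0 : 0 ≤ t / (n + 1 : ℕ) := by positivity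
  refine ⟨by simp, by field_simp, fun i _ => ⟨?_, le_rfl, ?_⟩⟩
  · exact mul_le_mul_of_nonneg_right (by exact_mod_cast Nat.le_succ i) h0
  · push_cast at *
    linarith

theorem tendsto_riemann_stieltjes_sum {t : ℝ} (ht : 0 ≤ t) {g F f : ℝ → ℝ}
    (hg : ContinuousOn g (Icc 0 t)) (hf : ContinuousOn f (Icc 0 t))
    (hF : ∀ u ∈ Icc 0 t, HasDerivAt F (f u) u) :
    Tendsto (fun n : ℕ => ∑ i ∈ Finset.range (n + 1), g ((i + 1 : ℕ) * (t / (n + 1 : ℕ))) *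
        (F ((i + 1 : ℕ) * (t / (n + 1 : ℕ))) - F (i * (t / (n + 1 : ℕ))))) atTop
      (𝓝 (∫ u in (0 : ℝ)..t, g u * f u)) := by
  rw [Metric.tendsto_nhds]
  intro ε hε
  obtain ⟨δ, hδ, H⟩ := exists_mesh_abs_sum_sub_integral_lt hg hf hF hε
  have hlim : Tendsto (fun n : ℕ => t / (n + 1 : ℕ)) atTop (𝓝 0) :=
    (tendsto_const_div_atTop_nhds_zero_nat t).comp (tendsto_add_atTop_nat 1)
  filter_upwards [hlim.eventually (gt_mem_nhds hδ)] with n hn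
  exact H (n + 1) _ _ (isTaggedPartition_uniform ht n hn)

/-- The sums approximating the Wiener integral of `(T - u) ^ (-α)` against `b` on `[0, t]`. -/
noncomputable def wienerSum (α T t : ℝ) (b : ℝ → ℝ) (n : ℕ) : ℝ :=
  ∑ i ∈ Finset.range (n + 1), (T - i * (t / (n + 1 : ℕ))) ^ (-α) *
    (b ((i + 1 : ℕ) * (t / (n + 1 : ℕ))) - b (i * (t / (n + 1 : ℕ))))

/-- Summation by parts moves the increments onto the smooth weight. With `b 0 = 0`, what remains is
a boundary term and a Riemann-Stieltjes sum of `b`, tagged at right endpoints, whose limit is read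
off from `bridge_eq`. -/
theorem tendsto_wienerSum {T α t : ℝ} {b x : ℝ → ℝ} (hx : ContinuousOn x (Ico 0 T)) (hx0 : x 0 = 0)
    (heq : ∀ t ∈ Ico (0 : ℝ) T, x t = -α * (∫ u in (0 : ℝ)..t, x u / (T - u)) + b t)
    (ht : t ∈ Ico 0 T) :
    Tendsto (wienerSum α T t b) atTop (𝓝 ((T - t) ^ (-α) * x t)) := by
  have hb0 : b 0 = 0 := by
    have := heq 0 ⟨le_rfl, ht.1.trans_lt ht.2⟩
    rw [intervalIntegral.integral_same, hx0] at this
    linarith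
  have hlt : Icc 0 t ⊆ Iio T := fun u hu => hu.2.trans_lt ht.2
  have hb := (continuousOn_driver hx heq).mono (Icc_subset_Ico_of_lt ht.2)
  have h1 := tendsto_riemann_stieltjes_sum ht.1 hb
    (continuousOn_const.mul ((continuousOn_sub_rpow T (-α - 1)).mono hlt)).neg
    (fun u hu => hasDerivAt_sub_rpow (hlt hu) (-α))
  have h0 : 0 < T - t := sub_pos.2 ht.2
  have h2 : (T - t) ^ (-α) * x t = (T - t) ^ (-α) * b t -
      ∫ u in (0 : ℝ)..t, b u * -(-α * (T - u) ^ (-α - 1)) := by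
    have e1 : (T - t) ^ (-α) * (T - t) ^ α = 1 := by rw [← Real.rpow_add h0]; simp
    have e2 : ∫ u in (0 : ℝ)..t, b u * -(-α * (T - u) ^ (-α - 1)) =
        α * ∫ u in (0 : ℝ)..t, (T - u) ^ (-α - 1) * b u := by
      rw [← intervalIntegral.integral_const_mul]
      congr 1; ext u; ring
    rw [e2, bridge_eq hx heq ht]
    linear_combination (-α * ∫ u in (0 : ℝ)..t, (T - u) ^ (-α - 1) * b u) * e1
  rw [h2]
  refine (h1.const_sub ((T - t) ^ (-α) * b t)).congr fun n => ?_
  have h3 := Finset.sum_range_sub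
    (fun i : ℕ => (T - i * (t / (n + 1 : ℕ))) ^ (-α) * b (i * (t / (n + 1 : ℕ)))) (n + 1)
  have e : ((n + 1 : ℕ) : ℝ) * (t / (n + 1 : ℕ)) = t := by field_simp
  simp only [e, Nat.cast_zero, zero_mul, hb0, mul_zero, sub_zero] at h3
  rw [← h3, ← Finset.sum_sub_distrib, wienerSum]
  refine Finset.sum_congr rfl fun i _ => ?_
  ring

/-! ### Small ball bounds, measurability and the almost sure limit. -/

section Gaussian

variable {Ω : Type*} [MeasurableSpace Ω] {P : Measure Ω} {H T α : ℝ} {B X : ℝ → Ω → ℝ}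

theorem IsFBM.integral_sum_sq (hB : IsFBM P H T B) (n : ℕ) (c x : ℕ → ℝ)
    (hx : ∀ i ≤ n, x i ∈ Icc 0 T) :
    ∫ ω, (∑ i ∈ Finset.range n, c i * (B (x (i + 1)) ω - B (x i) ω)) ^ 2 ∂P =
      ∑ i ∈ Finset.range n, ∑ j ∈ Finset.range n, c i * c j *
        ∫ ω, (B (x (i + 1)) ω - B (x i) ω) * (B (x (j + 1)) ω - B (x j) ω) ∂P := by
  have hm : ∀ i ∈ Finset.range n, MemLp (fun ω => B (x (i + 1)) ω - B (x i) ω) 2 P := by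
    intro i hi
    rw [Finset.mem_range] at hi
    exact (hB.memLp_two (hx _ hi)).sub (hB.memLp_two (hx _ hi.le))
  have hi : ∀ i ∈ Finset.range n, ∀ j ∈ Finset.range n, Integrable (fun ω => c i * c j *
      ((B (x (i + 1)) ω - B (x i) ω) * (B (x (j + 1)) ω - B (x j) ω))) P :=
    fun i hi j hj => ((hm i hi).integrable_mul (hm j hj)).const_mul _
  simp only [pow_two, Finset.sum_mul_sum]
  rw [integral_finsetSum]
  · refine Finset.sum_congr rfl fun i hi' => ?_
    rw [integral_finsetSum]
    · refine Finset.sum_congr rfl fun j hj' => ?_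
      rw [← integral_const_mul]
      congr 1; ext ω; ring
    · intro j hj'
      exact (hi i hi' j hj').congr (Eventually.of_forall fun ω => by simp only; ring)
  · intro i hi'
    refine integrable_finsetSum _ fun j hj' => ?_
    exact (hi i hi' j hj').congr (Eventually.of_forall fun ω => by simp only; ring)

/-- Since increments are positively correlated, the variance of a positive combination of
increments is bounded below by that of the total increment. -/
theorem IsFBM.le_integral_sum_sq (hB : IsFBM P H T B) (hH : 1 / 2 ≤ H) (n : ℕ) (c x : ℕ → ℝ)
    (hx : ∀ i ≤ n, x i ∈ Icc 0 T) (hmono : Monotone x) {m : ℝ} (hm : 0 ≤ m)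
    (hc : ∀ i < n, m ≤ c i) :
    m ^ 2 * |x n - x 0| ^ (2 * H) ≤
      ∫ ω, (∑ i ∈ Finset.range n, c i * (B (x (i + 1)) ω - B (x i) ω)) ^ 2 ∂P := by
  -- Unit weights telescope to the total increment, so both sides become double sums over the same
  -- nonnegative covariances and compare term by term.
  have h1 := hB.integral_sum_sq n (fun _ => 1) x hx
  simp only [one_mul] at h1
  have h2 : ∀ ω, ∑ i ∈ Finset.range n, (B (x (i + 1)) ω - B (x i) ω) = B (x n) ω - B (x 0) ω :=
    fun ω => Finset.sum_range_sub (fun i => B (x i) ω) n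
  simp only [h2] at h1
  rw [hB.integral_increment_sq (by linarith) (hx 0 (Nat.zero_le n)) (hx n le_rfl)] at h1
  rw [hB.integral_sum_sq n c x hx, h1, Finset.mul_sum]
  refine Finset.sum_le_sum fun i hi => ?_
  rw [Finset.mul_sum]
  refine Finset.sum_le_sum fun j hj => ?_
  rw [Finset.mem_range] at hi hj
  have hpos : ∀ k l, k < l → l < n →
      0 ≤ ∫ ω, (B (x (k + 1)) ω - B (x k) ω) * (B (x (l + 1)) ω - B (x l) ω) ∂P :=
    fun k l hkl hl => hB.integral_increment_mul_nonneg hH (hx k (by omega)).1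
      (hmono (Nat.le_succ k)) (hmono hkl) (hmono (Nat.le_succ l)) (hx (l + 1) (by omega)).2
  have h0 : 0 ≤ ∫ ω, (B (x (i + 1)) ω - B (x i) ω) * (B (x (j + 1)) ω - B (x j) ω) ∂P := by
    rcases lt_trichotomy i j with h | rfl | h
    · exact hpos i j h hj
    · exact integral_nonneg fun ω => mul_self_nonneg _
    · simpa only [mul_comm] using hpos j i h hi
  refine mul_le_mul_of_nonneg_right ?_ h0
  rw [pow_two]
  exact mul_le_mul (hc i hi) (hc j hj) hm (hm.trans (hc i hi))

/-- The density is at most `1 / √(2 π v) ≤ 1 / σ`. -/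
theorem gaussianReal_Ioo_le {v : ℝ≥0} {σ : ℝ} (hσ : 0 < σ) (hv : σ ^ 2 ≤ v) {ε : ℝ} :
    gaussianReal 0 v (Ioo (-ε) ε) ≤ ENNReal.ofReal (2 * ε / σ) := by
  have hv0 : v ≠ 0 := by
    rintro rfl
    have : 0 < σ ^ 2 := by positivity
    simp at hv
    linarith
  have hpdf : ∀ y, gaussianPDF 0 v y ≤ ENNReal.ofReal σ⁻¹ := by
    intro y
    rw [gaussianPDF_def, gaussianPDFReal_def]
    refine ENNReal.ofReal_le_ofReal ?_
    have h1 : Real.exp (-(y - 0) ^ 2 / (2 * v)) ≤ 1 := by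
      rw [Real.exp_le_one_iff, neg_div]
      have : 0 ≤ (y - 0) ^ 2 / (2 * (v : ℝ)) := by positivity
      linarith
    have h2 : σ ≤ √(2 * Real.pi * v) := by
      refine Real.le_sqrt_of_sq_le ?_
      nlinarith [Real.pi_gt_three, v.coe_nonneg]
    calc _ ≤ (√(2 * Real.pi * v))⁻¹ * 1 := mul_le_mul_of_nonneg_left h1 (by positivity)
      _ ≤ σ⁻¹ := by rw [mul_one]; gcongr
  rw [gaussianReal_apply 0 hv0]
  calc _ ≤ ∫⁻ _ in Ioo (-ε) ε, ENNReal.ofReal σ⁻¹ := lintegral_mono hpdf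
    _ = ENNReal.ofReal (2 * ε / σ) := by
      rw [setLIntegral_const, Real.volume_Ioo, ← ENNReal.ofReal_mul (by positivity)]
      congr 1
      ring

/-- Bounds on the probability of open intervals pass to almost sure limits. -/
theorem measure_abs_lt_le_of_tendsto {Y : ℕ → Ω → ℝ} {Z : Ω → ℝ} {ε : ℝ} {C : ENNReal}
    (hlim : ∀ᵐ ω ∂P, Tendsto (fun n => Y n ω) atTop (𝓝 (Z ω)))
    (hY : ∀ n, P {ω | |Y n ω| < ε} ≤ C) : P {ω | |Z ω| < ε} ≤ C := by
  -- The interval is open, so a limit inside it forces `Y n ω` inside from some rank on. The sets `A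
  -- N` increase, hence continuity from below applies without measurability.
  set A : ℕ → Set Ω := fun N => {ω | ∀ n ≥ N, |Y n ω| < ε} with hA
  have hmono : Monotone A := fun N M hNM ω hω n hn => hω n (hNM.trans hn)
  calc P {ω | |Z ω| < ε} ≤ P (⋃ N, A N) := by
        refine measure_mono_ae ?_
        filter_upwards [hlim] with ω hω hZ
        obtain ⟨N, hN⟩ := eventually_atTop.1 (hω.abs.eventually (gt_mem_nhds hZ))
        exact mem_iUnion.2 ⟨N, hN⟩
    _ = ⨆ N, P (A N) := hmono.measure_iUnion
    _ ≤ C := iSup_le fun N => (measure_mono (show A N ⊆ _ from fun ω hω => hω N le_rfl)).trans (hY N)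

theorem ae_ne_zero_of_measure_abs_lt_le {Z : Ω → ℝ} {C : ℝ}
    (h : ∀ ε > 0, P {ω | |Z ω| < ε} ≤ ENNReal.ofReal (C * ε)) : ∀ᵐ ω ∂P, Z ω ≠ 0 := by
  have hlim : Tendsto (fun ε : ℝ => ENNReal.ofReal (C * ε)) (𝓝[>] 0) (𝓝 0) := by
    have h1 : Tendsto (fun ε : ℝ => C * ε) (𝓝 0) (𝓝 (C * 0)) := tendsto_id.const_mul C
    rw [mul_zero] at h1
    have h2 := ENNReal.tendsto_ofReal h1
    rw [ENNReal.ofReal_zero] at h2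
    exact h2.mono_left nhdsWithin_le_nhds
  rw [ae_iff]
  refine le_antisymm (ge_of_tendsto hlim ?_) zero_le
  filter_upwards [self_mem_nhdsWithin] with ε hε
  refine (measure_mono fun ω hω => ?_).trans (h ε hε)
  have h0 : Z ω = 0 := not_not.1 hω
  simpa [h0] using hε

theorem mul_div_mem_Icc {t : ℝ} (ht : t ∈ Icc 0 T) {n i : ℕ} (hi : i ≤ n + 1) :
    (i : ℝ) * (t / (n + 1 : ℕ)) ∈ Icc 0 t := by
  have h0 := ht.1
  refine ⟨by positivity, ?_⟩
  have h1 : (i : ℝ) ≤ (n + 1 : ℕ) := by exact_mod_cast hi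
  rw [← mul_div_assoc, div_le_iff₀ (by positivity), mul_comm]
  gcongr

/-- All weights are at least `T ^ (-α)`, so the standard deviation is at least `T ^ (-α) * t ^ H`.
The bound does not depend on `n` and stays finite as `t` approaches `T`. -/
theorem IsFBM.measure_wienerSum_lt_le (hB : IsFBM P H T B) (hH : 1 / 2 ≤ H) (hα : 0 ≤ α) {t : ℝ}
    (ht0 : 0 < t) (ht : t < T) (n : ℕ) (ε : ℝ) :
    P {ω | |wienerSum α T t (fun u => B u ω) n| < ε} ≤
      ENNReal.ofReal (2 * ε / (T ^ (-α) * t ^ H)) := by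
  set x : ℕ → ℝ := fun i => i * (t / (n + 1 : ℕ)) with hx
  have hT : 0 < T := ht0.trans ht
  have hxm : ∀ i ≤ n + 1, x i ∈ Icc 0 T := fun i hi =>
    Icc_subset_Icc_right ht.le (mul_div_mem_Icc ⟨ht0.le, ht.le⟩ hi)
  have hxt : ∀ i ≤ n + 1, x i ≤ t := fun i hi => (mul_div_mem_Icc ⟨ht0.le, ht.le⟩ hi).2
  have hmono : Monotone x := fun i j hij => by
    simp only [hx]
    gcongr
  have hσ : 0 < T ^ (-α) * t ^ H := by positivity
  have hvar := hB.le_integral_sum_sq hH (n + 1) (fun i => (T - x i) ^ (-α)) x hxm hmono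
    (m := T ^ (-α)) (by positivity) (fun i hi =>
      Real.rpow_le_rpow_of_nonpos (sub_pos.2 ((hxt i hi.le).trans_lt ht))
        (sub_le_self T (hxm i hi.le).1) (by linarith))
  have e0 : x 0 = 0 := by simp [hx]
  have en : x (n + 1) = t := by simp only [hx]; field_simp
  rw [e0, en, sub_zero, abs_of_pos ht0] at hvar
  have hmap := hB.map_sum (n + 1) (fun i => (T - x i) ^ (-α)) x hxm
  have hlaw := hB.hasGaussianLaw_sum (n + 1) (fun i => (T - x i) ^ (-α)) x hxm
  have hset : {ω | |wienerSum α T t (fun u => B u ω) n| < ε} =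
      (fun ω => ∑ i ∈ Finset.range (n + 1), (T - x i) ^ (-α) * (B (x (i + 1)) ω - B (x i) ω)) ⁻¹'
        Ioo (-ε) ε := by
    ext ω
    simp only [wienerSum, mem_ofPred_eq, abs_lt, mem_preimage, mem_Ioo, hx]
  rw [hset, ← Measure.map_apply_of_aemeasurable hlaw.aemeasurable measurableSet_Ioo, hmap]
  refine gaussianReal_Ioo_le hσ ?_
  refine le_trans (le_of_eq ?_) (hvar.trans (Real.le_coe_toNNReal _))
  rw [mul_pow, ← Real.rpow_natCast (t ^ H), ← Real.rpow_mul ht0.le, mul_comm H]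
  norm_num

theorem ae_tendsto_wienerSum (hX : IsBridge P α T B X) {t : ℝ} (ht : t ∈ Ico 0 T) :
    ∀ᵐ ω ∂P, Tendsto (fun n => wienerSum α T t (fun u => B u ω) n) atTop
      (𝓝 ((T - t) ^ (-α) * X t ω)) := by
  filter_upwards [hX] with ω hω
  exact tendsto_wienerSum hω.1 hω.2.1 hω.2.2 ht

theorem IsBridge.aemeasurable (hX : IsBridge P α T B X) (hB : IsFBM P H T B) {t : ℝ}
    (ht : t ∈ Ico 0 T) : AEMeasurable (X t) P := by
  have h1 : AEMeasurable (fun ω => (T - t) ^ (-α) * X t ω) P := by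
    refine aemeasurable_of_tendsto_metrizable_ae' (fun n => ?_) (ae_tendsto_wienerSum hX ht)
    refine Finset.aemeasurable_fun_sum _ fun i hi => ?_
    rw [Finset.mem_range] at hi
    have hm : ∀ j ≤ n + 1, AEMeasurable (B (j * (t / (n + 1 : ℕ)))) P := fun j hj =>
      hB.aemeasurable (Icc_subset_Icc_right ht.2.le (mul_div_mem_Icc ⟨ht.1, ht.2.le⟩ hj))
    exact ((hm (i + 1) hi).sub (hm i hi.le)).const_mul _
  have h2 := h1.const_mul ((T - t) ^ α)
  refine h2.congr (Eventually.of_forall fun ω => ?_)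
  have h0 : 0 < T - t := sub_pos.2 ht.2
  have e1 : (T - t) ^ α * (T - t) ^ (-α) = 1 := by rw [← Real.rpow_add h0]; simp
  simp only
  rw [← mul_assoc, e1, one_mul]

theorem IsBridge.aemeasurable_integral (hX : IsBridge P α T B X) (hB : IsFBM P H T B) {t : ℝ}
    (ht : t ∈ Ico 0 T) :
    AEMeasurable (fun ω => ∫ u in (0 : ℝ)..t, X u ω ^ 2 / (T - u) ^ 2) P := by
  refine aemeasurable_of_tendsto_metrizable_ae' (f := fun (n : ℕ) ω =>
    ∑ i ∈ Finset.range (n + 1), (X ((i + 1 : ℕ) * (t / (n + 1 : ℕ))) ω /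
      (T - (i + 1 : ℕ) * (t / (n + 1 : ℕ)))) ^ 2 *
        ((i + 1 : ℕ) * (t / (n + 1 : ℕ)) - i * (t / (n + 1 : ℕ)))) (fun n => ?_) ?_
  · refine Finset.aemeasurable_fun_sum _ fun i hi => ?_
    rw [Finset.mem_range] at hi
    have hm := hX.aemeasurable hB (t := (i + 1 : ℕ) * (t / (n + 1 : ℕ)))
      (Icc_subset_Ico_of_lt ht.2 (mul_div_mem_Icc ⟨ht.1, ht.2.le⟩ hi))
    exact ((hm.div_const _).pow_const 2).mul_const _
  · filter_upwards [hX] with ω hω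
    have hc := ((integrand_continuousOn hω.1).mono (Icc_subset_Ico_of_lt ht.2)).pow 2
    have := tendsto_riemann_stieltjes_sum ht.1 hc (continuousOn_const (c := (1 : ℝ)))
      (fun u _ => hasDerivAt_id u)
    simpa [div_pow] using this

theorem IsBridge.ae_holderOn (hX : IsBridge P α T B X) (hB : IsFBM P H T B) (hT : 0 < T) {h : ℝ}
    (hh : 0 < h) (hhH : h < H) : ∀ᵐ ω ∂P, HolderOn (fun t => B t ω) h (Ico 0 T) := by
  refine hB.ae_holderOn hT hh hhH ?_
  filter_upwards [hX] with ω hω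
  exact continuousOn_driver hω.1 hω.2.2

/-- One null set serves all `t`, as a limit over the continuum `t → T` requires. -/
theorem IsBridge.ae_lse_eq (hX : IsBridge P α T B X) (hB : IsFBM P H T B) (hT : 0 < T)
    (hH : 1 / 2 < H) (hH1 : H < 1) :
    ∀ᵐ ω ∂P, ∀ t ∈ Ico 0 T, lse T X t ω =
      -((X t ω ^ 2 / (T - t) - ∫ u in (0 : ℝ)..t, X u ω ^ 2 / (T - u) ^ 2) / 2) /
        ∫ u in (0 : ℝ)..t, X u ω ^ 2 / (T - u) ^ 2 := by
  obtain ⟨h, hh, hhH⟩ := exists_between hH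
  filter_upwards [hX, hX.ae_holderOn hB hT (by linarith) hhH] with ω hω hω' t ht
  exact neg_youngIntegral_bridge_div hh (hhH.trans hH1) ht
    (bridge_holder (hhH.trans hH1).le hω.1 hω.2.2 hω' ht.2) hω.2.1

theorem IsBridge.aemeasurable_lse (hX : IsBridge P α T B X) (hB : IsFBM P H T B) (hT : 0 < T)
    (hH : 1 / 2 < H) (hH1 : H < 1) {t : ℝ} (ht : t ∈ Ico 0 T) : AEMeasurable (lse T X t) P := by
  have hD := hX.aemeasurable_integral hB ht
  have h1 := (((((hX.aemeasurable hB ht).pow_const 2).div_const (T - t)).sub hD).div_const 2).neg.div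
    hD
  refine h1.congr ?_
  filter_upwards [hX.ae_lse_eq hB hT hH hH1] with ω hω
  exact (hω t ht).symm

theorem IsBridge.ae_tendsto_normalized (hX : IsBridge P α T B X) (hB : IsFBM P H T B) (hT : 0 < T)
    (hH : 1 / 2 ≤ H) (hα : 0 < α) (hαH : α < H) :
    ∀ᵐ ω ∂P, ∃ l, l ≠ 0 ∧ Tendsto (fun t => (T - t) ^ (-α) * X t ω) (𝓝[<] T) (𝓝 l) := by
  obtain ⟨h, hαh, hhH⟩ := exists_between hαH
  have hex : ∀ᵐ ω ∂P, ∃ l, Tendsto (fun t => (T - t) ^ (-α) * X t ω) (𝓝[<] T) (𝓝 l) := by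
    filter_upwards [hX, hX.ae_holderOn hB hT (hα.trans hαh) hhH] with ω hω hω'
    exact exists_tendsto_normalized_bridge hT hα hαh hω.1 hω.2.2 hω'
  set Z : Ω → ℝ := fun ω => limUnder (𝓝[<] T) (fun t => (T - t) ^ (-α) * X t ω)
  have hZ : ∀ᵐ ω ∂P, Tendsto (fun t => (T - t) ^ (-α) * X t ω) (𝓝[<] T) (𝓝 (Z ω)) := by
    filter_upwards [hex] with ω hω
    exact tendsto_nhds_limUnder hω
  obtain ⟨s, -, hs, hsT⟩ := exists_seq_strictMono_tendsto' (show T / 2 < T by linarith)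
  -- Staying above `T / 2` makes the small ball constant uniform in `m`. The bound then passes to
  -- the limit twice: over partitions at fixed `s m`, then as `s m → T`.
  have hsm : ∀ m, T / 2 < s m ∧ s m < T := fun m => hs m
  have hslim : Tendsto s atTop (𝓝[<] T) :=
    tendsto_nhdsWithin_iff.2 ⟨hsT, Eventually.of_forall fun m => (hsm m).2⟩
  have hne : ∀ᵐ ω ∂P, Z ω ≠ 0 := by
    refine ae_ne_zero_of_measure_abs_lt_le (C := 2 / (T ^ (-α) * (T / 2) ^ H)) fun ε hε => ?_
    refine measure_abs_lt_le_of_tendsto (Y := fun m ω => (T - s m) ^ (-α) * X (s m) ω) ?_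
      fun m => ?_
    · filter_upwards [hZ] with ω hω
      exact hω.comp hslim
    · have h0 : 0 < s m := by linarith [(hsm m).1]
      refine measure_abs_lt_le_of_tendsto (ae_tendsto_wienerSum hX ⟨h0.le, (hsm m).2⟩) fun n => ?_
      refine (hB.measure_wienerSum_lt_le hH hα.le h0 (hsm m).2 n ε).trans ?_
      refine ENNReal.ofReal_le_ofReal ?_
      rw [mul_comm 2 ε, mul_div_assoc, mul_comm ε]
      have := (hsm m).1.le
      gcongr
  filter_upwards [hZ, hne] with ω h1 h2
  exact ⟨Z ω, h2, h1⟩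

/-- The increment from time `0` is a nondegenerate Gaussian, without atoms, and the bridge equation
at time `0` gives `B 0 = 0`. -/
theorem IsBridge.ae_driver_ne_zero (hX : IsBridge P α T B X) (hB : IsFBM P H T B) (hH : 0 < H)
    {t : ℝ} (ht0 : 0 < t) (ht : t < T) : ∀ᵐ ω ∂P, B t ω ≠ 0 := by
  have h0 : (0 : ℝ) ∈ Icc 0 T := ⟨le_rfl, (ht0.trans ht).le⟩
  have h1 := hB.map_increment hH h0 ⟨ht0.le, ht.le⟩
  have hm : AEMeasurable (fun ω => B t ω - B 0 ω) P :=
    (hB.aemeasurable ⟨ht0.le, ht.le⟩).sub (hB.aemeasurable h0)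
  have hv : (|t - 0| ^ (2 * H)).toNNReal ≠ 0 := by
    rw [sub_zero, abs_of_pos ht0]
    exact (Real.toNNReal_pos.2 (by positivity)).ne'
  have h2 : P ((fun ω => B t ω - B 0 ω) ⁻¹' {0}) = 0 := by
    rw [← Measure.map_apply_of_aemeasurable hm (measurableSet_singleton 0), h1]
    exact gaussianReal_absolutelyContinuous 0 hv (by simp)
  have h3 : ∀ᵐ ω ∂P, B t ω - B 0 ω ≠ 0 := by
    rw [ae_iff]
    convert h2 using 2
    ext ω
    simp
  filter_upwards [h3, hX] with ω hω hω'
  have h4 := hω'.2.2 0 ⟨le_rfl, ht0.trans ht⟩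
  rw [intervalIntegral.integral_same, hω'.2.1] at h4
  have h5 : B 0 ω = 0 := by linarith
  rwa [h5, sub_zero] at hω

theorem IsBridge.ae_tendsto_lse (hX : IsBridge P α T B X) (hB : IsFBM P H T B) (hT : 0 < T)
    (hH : 1 / 2 < H) (hH1 : H < 1) (hα : 0 < α) :
    ∀ᵐ ω ∂P, Tendsto (fun t => lse T X t ω) (𝓝[<] T) (𝓝 (min α (1 / 2))) := by
  have hcongr : ∀ ω, (∀ t ∈ Ico 0 T, lse T X t ω =
      -((X t ω ^ 2 / (T - t) - ∫ u in (0 : ℝ)..t, X u ω ^ 2 / (T - u) ^ 2) / 2) /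
        ∫ u in (0 : ℝ)..t, X u ω ^ 2 / (T - u) ^ 2) → (fun t =>
      -((X t ω ^ 2 / (T - t) - ∫ u in (0 : ℝ)..t, X u ω ^ 2 / (T - u) ^ 2) / 2) /
        ∫ u in (0 : ℝ)..t, X u ω ^ 2 / (T - u) ^ 2) =ᶠ[𝓝[<] T] fun t => lse T X t ω := by
    intro ω hω
    filter_upwards [Ioo_mem_nhdsLT hT] with t ht
    exact (hω t ⟨ht.1.le, ht.2⟩).symm
  rcases le_or_gt α (1 / 2) with h | h
  · rw [min_eq_left h]
    filter_upwards [hX, hX.ae_lse_eq hB hT hH hH1,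
      hX.ae_tendsto_normalized hB hT hH.le hα (h.trans_lt hH)] with ω hω hω' ⟨l, hl, hlim⟩
    exact (tendsto_half_sub_div_of_weak_drift hT h hω.1 hl hlim).congr' (hcongr ω hω')
  · rw [min_eq_right h.le]
    -- Here `r < H` gives Hölder paths, `r < α` the decay of the bridge at rate `r`, and `r > 1 / 2`
    -- makes `X_t ^ 2 / (T - t)` vanish.
    obtain ⟨r, hr, hr'⟩ := exists_between (lt_min hH h)
    have hrH := hr'.trans_le (min_le_left _ _)
    have hrα := hr'.trans_le (min_le_right _ _)
    have hT2 : T / 2 ∈ Ioo 0 T := ⟨by linarith, by linarith⟩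
    filter_upwards [hX, hX.ae_lse_eq hB hT hH hH1, hX.ae_holderOn hB hT (by linarith) hrH,
      hX.ae_driver_ne_zero hB (by linarith) hT2.1 hT2.2] with ω hω hω' hω'' hne
    exact (tendsto_half_sub_div_of_strong_drift hT hr hrα hω.1 hω.2.2 hω'' hT2 hne).congr'
      (hcongr ω hω')

end Gaussian

end FractionalBridge

/-! ### The three convergence statements. -/

theorem theorem1 {Ω : Type*} [MeasurableSpace Ω] (P : Measure Ω) [IsProbabilityMeasure P]
    (H T α : ℝ) (hH : 1 / 2 < H) (hH' : H < 1) (hT : 0 < T) (hα : 0 < α)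
    (B X : ℝ → Ω → ℝ)
    (hB : FractionalBridge.IsFBM P H T B)
    (hX : FractionalBridge.IsBridge P α T B X) :
    TendstoInMeasure P (FractionalBridge.lse T X) (𝓝[<] T) (fun _ => min α (1 / 2)) ∧
    (α < H →
      ∀ᵐ ω ∂P, Tendsto (fun t => FractionalBridge.lse T X t ω) (𝓝[<] T) (𝓝 (min α (1 / 2)))) ∧
    ((∀ᵐ ω ∂P, Tendsto (fun t => FractionalBridge.lse T X t ω) (𝓝[<] T) (𝓝 α)) ↔
      α ≤ 1 / 2) := by
  have hae := hX.ae_tendsto_lse hB hT hH hH' hα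
  refine ⟨?_, fun _ => hae, fun h => ?_, fun h => ?_⟩
  · intro ε hε
    refine tendsto_of_seq_tendsto fun s hs => ?_
    -- Almost sure convergence implies convergence in measure along sequences of measurable
    -- functions; the shift by `N` puts every time in `(0, T)`, where the estimator is almost
    -- everywhere measurable.
    obtain ⟨N, hN⟩ := eventually_atTop.1 (hs.eventually (Ioo_mem_nhdsLT hT))
    have hlim : TendstoInMeasure P (fun n => FractionalBridge.lse T X (s (n + N))) atTop
        (fun _ => min α (1 / 2)) := by
      refine tendstoInMeasure_of_tendsto_ae (fun n => ?_) ?_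
      · have hn := hN (n + N) (Nat.le_add_left N n)
        exact (hX.aemeasurable_lse hB hT hH hH' ⟨hn.1.le, hn.2⟩).aestronglyMeasurable
      · filter_upwards [hae] with ω hω
        exact hω.comp (hs.comp (tendsto_add_atTop_nat N))
    exact (tendsto_add_atTop_iff_nat N).1 (hlim ε hε)
  · obtain ⟨ω, h1, h2⟩ := (hae.and h).exists
    have := tendsto_nhds_unique h1 h2
    exact this ▸ min_le_right _ _
  · rwa [min_eq_left h] at hae
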